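/- Let $(\mathcal C,\mathbb E,\mathfrak s)$ be an extriangulated category in the sense of Nakaoka and Palu ($\mathcal C$ additive, $\mathbb E:\mathcal C^{\rm op}\times\mathcal C\to\mathrm{Ab}$ an additive bifunctor, $\mathfrak s$ an additive realization, satisfying (ET3), (ET3)$^{\rm op}$, (ET4), (ET4)$^{\rm op}$) which satisfies Condition (WIC): if $gf$ is an inflation then so is $f$, and if $gf$ is a deflation then so is $g$. Let $\xi$ be a proper class of $\mathbb E$-triangles, i.e. a class of $\mathbb E$-triangles that is closed under isomorphisms, finite coproducts, base change and cobase change, contains all split $\mathbb E$-triangles, and is saturated: whenever $A_i\to B_i\xrightarrow{y_i} Z$ are $\mathbb E$-triangles with extensions $\delta_i$ ($i=1,2$), and the second one and an $\mathbb E$-triangle $A_1\to W\to B_2$ with extension $y_2^*\delta_1$ lie in $\xi$, then so does the first one. For a class $\mathcal W$ of objects, an $\mathbb E$-triangle $A\to B\to Z$ in $\xi$ is $\mathcal C(\mathcal W,-)$-exact if $0\to\mathcal C(W,A)\to\mathcal C(W,B)\to\mathcal C(W,Z)\to0$ is exact for all $W\in\mathcal W$, and $\mathcal C(-,\mathcal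 W)$-exact if $0\to\mathcal C(Z,W)\to\mathcal C(B,W)\to\mathcal C(A,W)\to0$ is exact for all $W\in\mathcal W$. An object $P$ (resp. $I$) is $\xi$-projective (resp. $\xi$-injective) if every $\mathbb E$-triangle in $\xi$ is $\mathcal C(P,-)$-exact (resp. $\mathcal C(-,I)$-exact). Write $\mathcal P(\xi)$ and $\mathcal I(\xi)$ for the classes of these objects. Assume that there are enough $\xi$-projectives and enough $\xi$-injectives: every object $A$ admits $\mathbb E$-triangles $K\to P\to A$ and $A\to I\to L$ in $\xi$ with $P\in\mathcal P(\xi)$ and $I\in\mathcal I(\xi)$. An object is $\xi$-$\mathcal G$projective (resp. $\xi$-$\mathcal G$injective) if it is isomorphic to some $K_n$ in a family of $\mathbb E$-triangles $K_{n+1}\to X_n\to K_n$ in $\xi$ ($n\in\mathbb Z$) which are all $\mathcal C(-,\mathcal P(\xi))$-exact with all $X_n\in\mathcal P(\xi)$ (resp. all $\mathcal C(\mathcal I(\xi),-)$-exact with all $X_n\in\mathcal I(\xi)$). Write $\mathcal{GP}(\xi)$ and $\mathcal{GI}(\xi)$ for these classes. An object $A$ has $\xi$-$\mathcal G$projective dimension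 $\le n$ if $A\in\mathcal{GP}(\xi)$, or if $n\ge1$ and there is an $\mathbb E$-triangle $K\to G\to A$ in $\xi$ with $G\in\mathcal{GP}(\xi)$ and $K$ of $\xi$-$\mathcal G$projective dimension $\le n-1$; the $\xi$-$\mathcal G$injective dimension is defined dually. A $\xi$-$\mathcal G$projective resolution $\mathbf G\to M$ is a complex $\cdots\to G_1\to G_0\to M\to 0$ spliced from $\mathcal C(\mathcal{GP}(\xi),-)$-exact $\mathbb E$-triangles $K_{i+1}\to G_i\to K_i$ in $\xi$ ($i\ge0$) with $K_0=M$ and all $G_i\in\mathcal{GP}(\xi)$. Dually, a $\xi$-$\mathcal G$injective coresolution $N\to\mathbf E$ is a complex $0\to N\to E^0\to E^1\to\cdots$ spliced from $\mathcal C(-,\mathcal{GI}(\xi))$-exact $\mathbb E$-triangles $K^i\to E^i\to K^{i+1}$ in $\xi$ ($i\ge0$) with $K^0=N$ and all $E^i\in\mathcal{GI}(\xi)$. For these one puts $$\xi\mathrm{xt}^n_{\mathcal{GP}(\xi)}(M,N)=H^n\,\mathcal C(\mathbf G,N),\qquad \xi\mathrm{xt}^n_{\mathcal{GI}(\xi)}(M,N)=H^n\,\mathcal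 C(M,\mathbf E),$$ where $\mathbf G=(\cdots\to G_1\to G_0)$ and $\mathbf E=(E^0\to E^1\to\cdots)$. **Theorem (balance of $\xi$-Gorenstein cohomology).** Let $M$ have finite $\xi$-$\mathcal G$projective dimension and let $N$ have finite $\xi$-$\mathcal G$injective dimension. Then $M$ has a $\xi$-$\mathcal G$projective resolution, $N$ has a $\xi$-$\mathcal G$injective coresolution, and for every choice of these there is an isomorphism of abelian groups $$\xi\mathrm{xt}^n_{\mathcal{GP}(\xi)}(M,N)\cong\xi\mathrm{xt}^n_{\mathcal{GI}(\xi)}(M,N)\qquad\text{for all } n\ge1.$$ -/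

import Mathlib

open CategoryTheory CategoryTheory.Limits Opposite

universe w v u

namespace Extri

section Basic

variable {C : Type u} [Category.{v} C] [Preadditive C] [HasZeroObject C] [HasBinaryBiproducts C]

/-- The group `𝔼(Z, X)` of extensions, for a bifunctor `E : Cᵒᵖ × C ⥤ Ab` (in curried form). -/
abbrev Ext (E : Cᵒᵖ ⥤ C ⥤ AddCommGrpCat.{w}) (Z X : C) : Type w :=
  ((E.obj (op Z)).obj X : AddCommGrpCat.{w})

/-- `a_* δ`. -/
def push (E : Cᵒᵖ ⥤ C ⥤ AddCommGrpCat.{w}) {X X' Z : C} (a : X ⟶ X') (δ : Ext E Z X) :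
    Ext E Z X' :=
  ((E.obj (op Z)).map a).hom δ

/-- `c^* δ`. -/
def pull (E : Cᵒᵖ ⥤ C ⥤ AddCommGrpCat.{w}) {X Z Z' : C} (c : Z' ⟶ Z) (δ : Ext E Z X) :
    Ext E Z' X :=
  ((E.map c.op).app X).hom δ

/-- `δ ⊕ δ'`: the extension of `Z ⊞ Z'` by `X ⊞ X'` with components `(δ, 0, 0, δ')`. -/
noncomputable def extSum (E : Cᵒᵖ ⥤ C ⥤ AddCommGrpCat.{w}) {X X' Z Z' : C} (δ : Ext E Z X)
    (δ' : Ext E Z' X') : Ext E (Z ⊞ Z') (X ⊞ X') :=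
  pull E biprod.fst (push E biprod.inl δ) + pull E biprod.snd (push E biprod.inr δ')

/-- Two sequences `X ⟶ Y ⟶ Z` and `X ⟶ Y' ⟶ Z` are equivalent if there is an isomorphism
`Y ≅ Y'` compatible with the identities of `X` and `Z`. -/
def SeqEquiv {X Y Y' Z : C} (x : X ⟶ Y) (y : Y ⟶ Z) (x' : X ⟶ Y') (y' : Y' ⟶ Z) : Prop :=
  ∃ b : Y ≅ Y', x ≫ b.hom = x' ∧ b.hom ≫ y' = y

variable (C) in
/-- The structure of an extriangulated category (in the sense of Nakaoka and Palu) on an additive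
category `C`.  The realization `𝔰` is encoded by the relation `Realizes δ x y`, which says
`𝔰(δ) = [X --x--> Y --y--> Z]`; by `exists_realizes` and `realizes_iff`, for each `δ` it is
exactly one equivalence class of sequences. -/
structure Extriangulation where
  /-- The bifunctor `𝔼`. -/
  E : Cᵒᵖ ⥤ C ⥤ AddCommGrpCat.{w}
  /-- Additivity in the contravariant variable. -/
  additive_left : E.Additive
  /-- Additivity in the covariant variable. -/
  additive_right : ∀ Z : Cᵒᵖ, (E.obj Z).Additive
  /-- `𝔰(δ) = [x, y]`. -/
  Realizes : ∀ ⦃X Y Z : C⦄, Ext E Z X → (X ⟶ Y) → (Y ⟶ Z) → Prop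
  exists_realizes : ∀ ⦃X Z : C⦄ (δ : Ext E Z X),
    ∃ (Y : C) (x : X ⟶ Y) (y : Y ⟶ Z), Realizes δ x y
  realizes_iff : ∀ ⦃X Y Y' Z : C⦄ (δ : Ext E Z X) (x : X ⟶ Y) (y : Y ⟶ Z) (x' : X ⟶ Y')
    (y' : Y' ⟶ Z), Realizes δ x y → (Realizes δ x' y' ↔ SeqEquiv x y x' y')
  /-- `𝔰` is a realization: every morphism of extensions is realized by a morphism of
  sequences. -/
  realize_hom : ∀ ⦃X Y Z X' Y' Z' : C⦄ (δ : Ext E Z X) (δ' : Ext E Z' X')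
    (x : X ⟶ Y) (y : Y ⟶ Z) (x' : X' ⟶ Y') (y' : Y' ⟶ Z') (a : X ⟶ X') (c : Z ⟶ Z'),
    Realizes δ x y → Realizes δ' x' y' → push E a δ = pull E c δ' →
      ∃ b : Y ⟶ Y', x ≫ b = a ≫ x' ∧ y ≫ c = b ≫ y'
  /-- Additivity of `𝔰`, zero extensions. -/
  realizes_zero : ∀ X Z : C,
    Realizes (0 : Ext E Z X) (biprod.inl : X ⟶ X ⊞ Z) (biprod.snd : X ⊞ Z ⟶ Z)
  /-- Additivity of `𝔰`, direct sums. -/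
  realizes_sum : ∀ ⦃X Y Z X' Y' Z' : C⦄ (δ : Ext E Z X) (δ' : Ext E Z' X')
    (x : X ⟶ Y) (y : Y ⟶ Z) (x' : X' ⟶ Y') (y' : Y' ⟶ Z'),
    Realizes δ x y → Realizes δ' x' y' →
      Realizes (extSum E δ δ') (biprod.map x x') (biprod.map y y')
  /-- (ET3) -/
  et3 : ∀ ⦃X Y Z X' Y' Z' : C⦄ (δ : Ext E Z X) (δ' : Ext E Z' X')
    (x : X ⟶ Y) (y : Y ⟶ Z) (x' : X' ⟶ Y') (y' : Y' ⟶ Z') (a : X ⟶ X') (b : Y ⟶ Y'),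
    Realizes δ x y → Realizes δ' x' y' → x ≫ b = a ≫ x' →
      ∃ c : Z ⟶ Z', y ≫ c = b ≫ y' ∧ push E a δ = pull E c δ'
  /-- (ET3)ᵒᵖ -/
  et3_op : ∀ ⦃X Y Z X' Y' Z' : C⦄ (δ : Ext E Z X) (δ' : Ext E Z' X')
    (x : X ⟶ Y) (y : Y ⟶ Z) (x' : X' ⟶ Y') (y' : Y' ⟶ Z') (b : Y ⟶ Y') (c : Z ⟶ Z'),
    Realizes δ x y → Realizes δ' x' y' → y ≫ c = b ≫ y' →
      ∃ a : X ⟶ X', x ≫ b = a ≫ x' ∧ push E a δ = pull E c δ'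
  /-- (ET4) -/
  et4 : ∀ ⦃A B D G F : C⦄ (δ : Ext E D A) (δ' : Ext E F B)
    (f : A ⟶ B) (f' : B ⟶ D) (g : B ⟶ G) (g' : G ⟶ F),
    Realizes δ f f' → Realizes δ' g g' →
      ∃ (H : C) (h' : G ⟶ H) (d : D ⟶ H) (e : H ⟶ F) (δ'' : Ext E H A),
        Realizes δ'' (f ≫ g) h' ∧ f' ≫ d = g ≫ h' ∧ h' ≫ e = g' ∧
        Realizes (push E f' δ') d e ∧ pull E d δ'' = δ ∧ push E f δ'' = pull E e δ'
  /-- (ET4)ᵒᵖ -/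
  et4_op : ∀ ⦃A B D G F : C⦄ (δ : Ext E B D) (δ' : Ext E G F)
    (f' : D ⟶ A) (f : A ⟶ B) (g' : F ⟶ B) (g : B ⟶ G),
    Realizes δ f' f → Realizes δ' g' g →
      ∃ (H : C) (d : D ⟶ H) (e : H ⟶ F) (h' : H ⟶ A) (δ'' : Ext E G H),
        Realizes δ'' h' (f ≫ g) ∧ h' ≫ f = e ≫ g' ∧ d ≫ h' = f' ∧
        Realizes (pull E g' δ) d e ∧ push E e δ'' = δ' ∧ push E d δ = pull E g δ''

namespace Extriangulation

variable (𝓔 : Extriangulation.{w} C)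

/-- Inflations. -/
def Inflation {X Y : C} (x : X ⟶ Y) : Prop :=
  ∃ (Z : C) (y : Y ⟶ Z) (δ : Ext 𝓔.E Z X), 𝓔.Realizes δ x y

/-- Deflations. -/
def Deflation {Y Z : C} (y : Y ⟶ Z) : Prop :=
  ∃ (X : C) (x : X ⟶ Y) (δ : Ext 𝓔.E Z X), 𝓔.Realizes δ x y

/-- Condition (WIC). -/
def WIC : Prop :=
  (∀ ⦃X Y Z : C⦄ (f : X ⟶ Y) (g : Y ⟶ Z), 𝓔.Inflation (f ≫ g) → 𝓔.Inflation f) ∧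
  (∀ ⦃X Y Z : C⦄ (f : X ⟶ Y) (g : Y ⟶ Z), 𝓔.Deflation (f ≫ g) → 𝓔.Deflation g)

end Extriangulation

/-- A proper class `ξ` of `𝔼`-triangles; `mem x y δ` says that
`X --x--> Y --y--> Z --δ-->` is an `𝔼`-triangle which belongs to `ξ`. -/
structure ProperClass (𝓔 : Extriangulation.{w} C) where
  /-- Membership in `ξ`. -/
  mem : ∀ ⦃X Y Z : C⦄, (X ⟶ Y) → (Y ⟶ Z) → Ext 𝓔.E Z X → Prop
  /-- The members of `ξ` are `𝔼`-triangles. -/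
  realizes : ∀ ⦃X Y Z : C⦄ (x : X ⟶ Y) (y : Y ⟶ Z) (δ : Ext 𝓔.E Z X),
    mem x y δ → 𝓔.Realizes δ x y
  /-- Closure under isomorphisms of `𝔼`-triangles. -/
  of_iso : ∀ ⦃X Y Z X' Y' Z' : C⦄ (x : X ⟶ Y) (y : Y ⟶ Z) (δ : Ext 𝓔.E Z X)
    (x' : X' ⟶ Y') (y' : Y' ⟶ Z') (δ' : Ext 𝓔.E Z' X')
    (a : X ≅ X') (b : Y ≅ Y') (c : Z ≅ Z'),
    mem x y δ → 𝓔.Realizes δ' x' y' →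
    x ≫ b.hom = a.hom ≫ x' → y ≫ c.hom = b.hom ≫ y' →
    push 𝓔.E a.hom δ = pull 𝓔.E c.hom δ' → mem x' y' δ'
  /-- `ξ` contains all split `𝔼`-triangles (in particular the zero triangle, which is the empty
  coproduct). -/
  of_split : ∀ ⦃X Y Z : C⦄ (x : X ⟶ Y) (y : Y ⟶ Z),
    𝓔.Realizes (0 : Ext 𝓔.E Z X) x y → mem x y 0
  /-- Closure under (binary, hence finite) coproducts. -/
  coprod : ∀ ⦃X Y Z X' Y' Z' : C⦄ (x : X ⟶ Y) (y : Y ⟶ Z) (δ : Ext 𝓔.E Z X)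
    (x' : X' ⟶ Y') (y' : Y' ⟶ Z') (δ' : Ext 𝓔.E Z' X'),
    mem x y δ → mem x' y' δ' →
      mem (biprod.map x x') (biprod.map y y') (extSum 𝓔.E δ δ')
  /-- Closure under base change. -/
  base_change : ∀ ⦃X Y Z Y' Z' : C⦄ (x : X ⟶ Y) (y : Y ⟶ Z) (δ : Ext 𝓔.E Z X) (c : Z' ⟶ Z)
    (x' : X ⟶ Y') (y' : Y' ⟶ Z'),
    mem x y δ → 𝓔.Realizes (pull 𝓔.E c δ) x' y' → mem x' y' (pull 𝓔.E c δ)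
  /-- Closure under cobase change. -/
  cobase_change : ∀ ⦃X Y Z X' Y' : C⦄ (x : X ⟶ Y) (y : Y ⟶ Z) (δ : Ext 𝓔.E Z X) (a : X ⟶ X')
    (x' : X' ⟶ Y') (y' : Y' ⟶ Z),
    mem x y δ → 𝓔.Realizes (push 𝓔.E a δ) x' y' → mem x' y' (push 𝓔.E a δ)
  /-- `ξ` is saturated: given `𝔼`-triangles `X₁ ⟶ Y₁ ⟶ Z` (with extension `δ₁`) and
  `X₂ ⟶ Y₂ ⟶ Z` (with extension `δ₂`), if the second one and the `𝔼`-triangle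
  `X₁ ⟶ W ⟶ Y₂` with extension `y₂^* δ₁` belong to `ξ`, then so does the first one. -/
  saturated : ∀ ⦃X₁ Y₁ X₂ Y₂ Z W : C⦄ (x₁ : X₁ ⟶ Y₁) (y₁ : Y₁ ⟶ Z) (δ₁ : Ext 𝓔.E Z X₁)
    (x₂ : X₂ ⟶ Y₂) (y₂ : Y₂ ⟶ Z) (δ₂ : Ext 𝓔.E Z X₂) (m₁ : X₁ ⟶ W) (e₁ : W ⟶ Y₂),
    𝓔.Realizes δ₁ x₁ y₁ → mem x₂ y₂ δ₂ → mem m₁ e₁ (pull 𝓔.E y₂ δ₁) → mem x₁ y₁ δ₁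

/-- `0 → C(W, X) → C(W, Y) → C(W, Z) → 0` is exact. -/
def CovExact (W : C) {X Y Z : C} (x : X ⟶ Y) (y : Y ⟶ Z) : Prop :=
  Function.Injective (fun a : W ⟶ X => a ≫ x) ∧
  Function.Exact (fun a : W ⟶ X => a ≫ x) (fun b : W ⟶ Y => b ≫ y) ∧
  Function.Surjective (fun b : W ⟶ Y => b ≫ y)

/-- `0 → C(Z, W) → C(Y, W) → C(X, W) → 0` is exact. -/
def ContraExact (W : C) {X Y Z : C} (x : X ⟶ Y) (y : Y ⟶ Z) : Prop :=
  Function.Injective (fun c : Z ⟶ W => y ≫ c) ∧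
  Function.Exact (fun c : Z ⟶ W => y ≫ c) (fun b : Y ⟶ W => x ≫ b) ∧
  Function.Surjective (fun b : Y ⟶ W => x ≫ b)

end Basic

namespace ProperClass

variable {C : Type u} [Category.{v} C] [Preadditive C] [HasZeroObject C] [HasBinaryBiproducts C]
  {𝓔 : Extriangulation.{w} C} (ξ : ProperClass 𝓔)

/-- `ξ`-projective objects. -/
def Proj (P : C) : Prop :=
  ∀ ⦃X Y Z : C⦄ (x : X ⟶ Y) (y : Y ⟶ Z) (δ : Ext 𝓔.E Z X), ξ.mem x y δ → CovExact P x y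

/-- `ξ`-injective objects. -/
def Inj (I : C) : Prop :=
  ∀ ⦃X Y Z : C⦄ (x : X ⟶ Y) (y : Y ⟶ Z) (δ : Ext 𝓔.E Z X), ξ.mem x y δ → ContraExact I x y

/-- There are enough `ξ`-projectives. -/
def EnoughProj : Prop :=
  ∀ A : C, ∃ (K P : C) (x : K ⟶ P) (y : P ⟶ A) (δ : Ext 𝓔.E A K), ξ.mem x y δ ∧ ξ.Proj P

/-- There are enough `ξ`-injectives. -/
def EnoughInj : Prop :=
  ∀ A : C, ∃ (I K : C) (x : A ⟶ I) (y : I ⟶ K) (δ : Ext 𝓔.E K A), ξ.mem x y δ ∧ ξ.Inj I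

/-- The data exhibiting an (unbounded) complex `X` as a `ξ`-exact complex: `𝔼`-triangles
`K (n+1) --g n--> X n --f n--> K n --δ n-->` in `ξ` through which the differentials factor. -/
structure ExactData (X : ChainComplex C ℤ) where
  /-- The syzygies. -/
  K : ℤ → C
  /-- The inflations. -/
  g : ∀ n : ℤ, K (n + 1) ⟶ X.X n
  /-- The deflations. -/
  f : ∀ n : ℤ, X.X n ⟶ K n
  /-- The extensions. -/
  δ : ∀ n : ℤ, Ext 𝓔.E (K n) (K (n + 1))
  mem : ∀ n : ℤ, ξ.mem (g n) (f n) (δ n)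
  d_eq : ∀ n : ℤ, X.d (n + 1) n = f (n + 1) ≫ g n

/-- `ξ`-`𝒢`projective objects: the syzygies `K n` of complete `ξ`-projective resolutions, i.e. of
`ξ`-exact complexes of `ξ`-projective objects whose `𝔼`-triangles are
`C(-, 𝒫(ξ))`-exact. -/
def GProj (A : C) : Prop :=
  ∃ (P : ChainComplex C ℤ) (D : ξ.ExactData P),
    (∀ n : ℤ, ξ.Proj (P.X n)) ∧
    (∀ (n : ℤ) (Q : C), ξ.Proj Q → ContraExact Q (D.g n) (D.f n)) ∧
    ∃ n : ℤ, Nonempty (D.K n ≅ A)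

/-- `ξ`-`𝒢`injective objects: the syzygies `K n` of complete `ξ`-injective coresolutions, i.e. of
`ξ`-exact complexes of `ξ`-injective objects whose `𝔼`-triangles are
`C(ℐ(ξ), -)`-exact. -/
def GInj (A : C) : Prop :=
  ∃ (I : ChainComplex C ℤ) (D : ξ.ExactData I),
    (∀ n : ℤ, ξ.Inj (I.X n)) ∧
    (∀ (n : ℤ) (J : C), ξ.Inj J → CovExact J (D.g n) (D.f n)) ∧
    ∃ n : ℤ, Nonempty (D.K n ≅ A)

/-- `GPdLE n A`: the `ξ`-`𝒢`projective dimension of `A` is at most `n`. -/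
inductive GPdLE : ℕ → C → Prop
  | of_gproj (n : ℕ) (A : C) : ξ.GProj A → GPdLE n A
  | of_triangle (n : ℕ) (K G A : C) (x : K ⟶ G) (y : G ⟶ A) (δ : Ext 𝓔.E A K) :
      ξ.mem x y δ → ξ.GProj G → GPdLE n K → GPdLE (n + 1) A

/-- `GIdLE n A`: the `ξ`-`𝒢`injective dimension of `A` is at most `n`. -/
inductive GIdLE : ℕ → C → Prop
  | of_ginj (n : ℕ) (A : C) : ξ.GInj A → GIdLE n A
  | of_triangle (n : ℕ) (A G K : C) (x : A ⟶ G) (y : G ⟶ K) (δ : Ext 𝓔.E K A) :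
      ξ.mem x y δ → ξ.GInj G → GIdLE n K → GIdLE (n + 1) A

/-- Objects of finite `ξ`-`𝒢`projective dimension. -/
def FiniteGPd (M : C) : Prop := ∃ n : ℕ, ξ.GPdLE n M

/-- Objects of finite `ξ`-`𝒢`injective dimension. -/
def FiniteGId (N : C) : Prop := ∃ n : ℕ, ξ.GIdLE n N

/-- A `ξ`-`𝒢`projective resolution `⋯ ⟶ G 1 ⟶ G 0 ⟶ M ⟶ 0` of `M`, where the augmentation is
`f 0 : G 0 ⟶ K 0 = M` and each `f i : G i ⟶ K i` is a `ξ`-`𝒢`projective precover. -/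
structure GProjResolution (M : C) where
  /-- The complex `⋯ ⟶ G 1 ⟶ G 0`. -/
  G : ChainComplex C ℕ
  /-- The syzygies. -/
  K : ℕ → C
  K_zero : K 0 = M
  /-- The inflations. -/
  g : ∀ i : ℕ, K (i + 1) ⟶ G.X i
  /-- The deflations. -/
  f : ∀ i : ℕ, G.X i ⟶ K i
  /-- The extensions. -/
  δ : ∀ i : ℕ, Ext 𝓔.E (K i) (K (i + 1))
  mem : ∀ i : ℕ, ξ.mem (g i) (f i) (δ i)
  d_eq : ∀ i : ℕ, G.d (i + 1) i = f (i + 1) ≫ g i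
  gproj : ∀ i : ℕ, ξ.GProj (G.X i)
  exact : ∀ (i : ℕ) (W : C), ξ.GProj W → CovExact W (g i) (f i)

/-- A `ξ`-`𝒢`injective coresolution `0 ⟶ N ⟶ E 0 ⟶ E 1 ⟶ ⋯` of `N`, where the coaugmentation is
`g 0 : N = K 0 ⟶ E 0` and each `g i : K i ⟶ E i` is a `ξ`-`𝒢`injective preenvelope. -/
structure GInjCoresolution (N : C) where
  /-- The complex `E 0 ⟶ E 1 ⟶ ⋯`. -/
  E : CochainComplex C ℕ
  /-- The cosyzygies. -/
  K : ℕ → C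
  K_zero : K 0 = N
  /-- The inflations. -/
  g : ∀ i : ℕ, K i ⟶ E.X i
  /-- The deflations. -/
  f : ∀ i : ℕ, E.X i ⟶ K (i + 1)
  /-- The extensions. -/
  δ : ∀ i : ℕ, Ext 𝓔.E (K (i + 1)) (K i)
  mem : ∀ i : ℕ, ξ.mem (g i) (f i) (δ i)
  d_eq : ∀ i : ℕ, E.d i (i + 1) = f i ≫ g (i + 1)
  ginj : ∀ i : ℕ, ξ.GInj (E.X i)
  exact : ∀ (i : ℕ) (W : C), ξ.GInj W → ContraExact W (g i) (f i)

variable {ξ}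

/-- `ξxt^n_{𝒢𝒫(ξ)}(M, N) = H^n C(G, N)`, computed from a given `ξ`-`𝒢`projective resolution of
`M`. -/
noncomputable def GProjResolution.xt {M : C} (R : ξ.GProjResolution M) (N : C) (n : ℕ) :
    AddCommGrpCat.{v} :=
  (((preadditiveYoneda.obj N).mapHomologicalComplex _).obj R.G.op).homology n

/-- `ξxt^n_{𝒢ℐ(ξ)}(M, N) = H^n C(M, E)`, computed from a given `ξ`-`𝒢`injective coresolution of
`N`. -/
noncomputable def GInjCoresolution.xt {N : C} (S : ξ.GInjCoresolution N) (M : C) (n : ℕ) :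
    AddCommGrpCat.{v} :=
  (((preadditiveCoyoneda.obj (op M)).mapHomologicalComplex _).obj S.E).homology n

end ProperClass

end Extri

/-! With enough `ξ`-projectives, saturation identifies `ξ` with the 𝔼-triangles whose extension
vanishes after base change to every `ξ`-projective. With enough `ξ`-injectives these are also the
extensions killed by every pushout to a `ξ`-injective. They form a subbifunctor of 𝔼 closed under
(ET4) and its dual, so `ξ` becomes an extriangulated structure of its own (`ProperClass.system`).
The axioms of `TriangleSystem` are self-dual, so injective statements follow from projective ones
via `TriangleSystem.op`.

The core is `FGP.contra_resolution`: every Gorenstein projective resolution of `M` remains exact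
under `C(-, E)` for `E` Gorenstein injective. A triangle `F ⟶ G ⟶ M` with `F` of finite projective
dimension is both `C(𝒢𝒫, -)`-exact and `C(-, 𝒢ℐ)`-exact (`ProjTest.cov`, `InjTest.contra`), and the
Auslander–Buchweitz approximation `FGP.exists_approx` provides one with `G` Gorenstein projective.
This is transferred to an arbitrary resolution without showing that its syzygies have finite
dimension. The invariant carried along is weaker: the identity of each syzygy is a sum of
endomorphisms factoring through objects of finite Gorenstein projective dimension (`FactorsFGP`).

With the dual statement, the bicomplex `C(G i, E j)` has exact rows and columns away from its edges.
Dimension shifting along the syzygies of `M` then identifies the two cohomologies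
(`nonempty_balance_iso`). -/

namespace Extri

/-! ### Triangle systems and their opposites. -/

/-- A self-dual abstraction of a category with extension groups and distinguished triangles
`X ⟶ Y ⟶ Z` realizing every extension. -/
structure TriangleSystem (C : Type u) [Category.{v} C] [Preadditive C] where
  /-- The extension groups. -/
  Ext : C → C → Type w
  /-- The group structure. -/
  grp : ∀ Z X, AddCommGroup (Ext Z X)
  /-- Covariant functoriality. -/
  push : ∀ {X X' Z : C}, (X ⟶ X') → Ext Z X →+ Ext Z X'
  /-- Contravariant functoriality. -/
  pull : ∀ {X Z Z' : C}, (Z' ⟶ Z) → Ext Z X →+ Ext Z' X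
  push_id : ∀ {X Z : C} (δ : Ext Z X), push (𝟙 X) δ = δ
  push_comp : ∀ {X X' X'' Z : C} (a : X ⟶ X') (b : X' ⟶ X'') (δ : Ext Z X),
    push (a ≫ b) δ = push b (push a δ)
  pull_id : ∀ {X Z : C} (δ : Ext Z X), pull (𝟙 Z) δ = δ
  pull_comp : ∀ {X Z Z' Z'' : C} (c : Z'' ⟶ Z') (d : Z' ⟶ Z) (δ : Ext Z X),
    pull (c ≫ d) δ = pull c (pull d δ)
  push_pull : ∀ {X X' Z Z' : C} (a : X ⟶ X') (c : Z' ⟶ Z) (δ : Ext Z X),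
    push a (pull c δ) = pull c (push a δ)
  push_add : ∀ {X X' Z : C} (a b : X ⟶ X') (δ : Ext Z X), push (a + b) δ = push a δ + push b δ
  pull_add : ∀ {X Z Z' : C} (c d : Z' ⟶ Z) (δ : Ext Z X), pull (c + d) δ = pull c δ + pull d δ
  /-- Realization. -/
  Tri : ∀ ⦃X Y Z : C⦄, Ext Z X → (X ⟶ Y) → (Y ⟶ Z) → Prop
  exists_tri : ∀ ⦃X Z : C⦄ (δ : Ext Z X), ∃ (Y : C) (x : X ⟶ Y) (y : Y ⟶ Z), Tri δ x y
  tri_iff : ∀ ⦃X Y Y' Z : C⦄ (δ : Ext Z X) (x : X ⟶ Y) (y : Y ⟶ Z) (x' : X ⟶ Y')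
    (y' : Y' ⟶ Z), Tri δ x y → (Tri δ x' y' ↔ SeqEquiv x y x' y')
  realize_hom : ∀ ⦃X Y Z X' Y' Z' : C⦄ (δ : Ext Z X) (δ' : Ext Z' X')
    (x : X ⟶ Y) (y : Y ⟶ Z) (x' : X' ⟶ Y') (y' : Y' ⟶ Z') (a : X ⟶ X') (c : Z ⟶ Z'),
    Tri δ x y → Tri δ' x' y' → push a δ = pull c δ' →
      ∃ b : Y ⟶ Y', x ≫ b = a ≫ x' ∧ y ≫ c = b ≫ y'
  exists_sum : ∀ A B : C, ∃ (S : C) (inl : A ⟶ S) (inr : B ⟶ S) (fst : S ⟶ A) (snd : S ⟶ B),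
    inl ≫ fst = 𝟙 A ∧ inr ≫ snd = 𝟙 B ∧ inl ≫ snd = 0 ∧ inr ≫ fst = 0 ∧
    fst ≫ inl + snd ≫ inr = 𝟙 S ∧ Tri 0 inl snd ∧ Tri 0 inr fst
  et3 : ∀ ⦃X Y Z X' Y' Z' : C⦄ (δ : Ext Z X) (δ' : Ext Z' X')
    (x : X ⟶ Y) (y : Y ⟶ Z) (x' : X' ⟶ Y') (y' : Y' ⟶ Z') (a : X ⟶ X') (b : Y ⟶ Y'),
    Tri δ x y → Tri δ' x' y' → x ≫ b = a ≫ x' →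
      ∃ c : Z ⟶ Z', y ≫ c = b ≫ y' ∧ push a δ = pull c δ'
  et3_op : ∀ ⦃X Y Z X' Y' Z' : C⦄ (δ : Ext Z X) (δ' : Ext Z' X')
    (x : X ⟶ Y) (y : Y ⟶ Z) (x' : X' ⟶ Y') (y' : Y' ⟶ Z') (b : Y ⟶ Y') (c : Z ⟶ Z'),
    Tri δ x y → Tri δ' x' y' → y ≫ c = b ≫ y' →
      ∃ a : X ⟶ X', x ≫ b = a ≫ x' ∧ push a δ = pull c δ'
  et4 : ∀ ⦃A B D G F : C⦄ (δ : Ext D A) (δ' : Ext F B)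
    (f : A ⟶ B) (f' : B ⟶ D) (g : B ⟶ G) (g' : G ⟶ F),
    Tri δ f f' → Tri δ' g g' →
      ∃ (H : C) (h' : G ⟶ H) (d : D ⟶ H) (e : H ⟶ F) (δ'' : Ext H A),
        Tri δ'' (f ≫ g) h' ∧ f' ≫ d = g ≫ h' ∧ h' ≫ e = g' ∧
        Tri (push f' δ') d e ∧ pull d δ'' = δ ∧ push f δ'' = pull e δ'
  et4_op : ∀ ⦃A B D G F : C⦄ (δ : Ext B D) (δ' : Ext G F)
    (f' : D ⟶ A) (f : A ⟶ B) (g' : F ⟶ B) (g : B ⟶ G),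
    Tri δ f' f → Tri δ' g' g →
      ∃ (H : C) (d : D ⟶ H) (e : H ⟶ F) (h' : H ⟶ A) (δ'' : Ext G H),
        Tri δ'' h' (f ≫ g) ∧ h' ≫ f = e ≫ g' ∧ d ≫ h' = f' ∧
        Tri (pull g' δ) d e ∧ push e δ'' = δ' ∧ push d δ = pull g δ''

namespace TriangleSystem

attribute [instance] TriangleSystem.grp

variable {C : Type u} [Category.{v} C] [Preadditive C] (𝒯 : TriangleSystem.{w} C)

/-- The opposite triangle system. -/
def op : TriangleSystem.{w} Cᵒᵖ where
  Ext Z X := 𝒯.Ext X.unop Z.unop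
  grp Z X := 𝒯.grp X.unop Z.unop
  push a := 𝒯.pull a.unop
  pull c := 𝒯.push c.unop
  push_id δ := 𝒯.pull_id δ
  push_comp a b δ := 𝒯.pull_comp _ _ δ
  pull_id δ := 𝒯.push_id δ
  pull_comp a b δ := 𝒯.push_comp _ _ δ
  push_pull a c δ := (𝒯.push_pull _ _ δ).symm
  push_add a b δ := 𝒯.pull_add _ _ δ
  pull_add a b δ := 𝒯.push_add _ _ δ
  Tri X Y Z δ x y := 𝒯.Tri δ y.unop x.unop
  exists_tri X Z δ := by
    obtain ⟨Y, x, y, h⟩ := 𝒯.exists_tri δ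
    exact ⟨Opposite.op Y, y.op, x.op, h⟩
  tri_iff X Y Y' Z δ x y x' y' h := by
    refine (𝒯.tri_iff δ _ _ y'.unop x'.unop h).trans ⟨?_, ?_⟩
    · rintro ⟨b, h₁, h₂⟩
      exact ⟨b.op.symm, Quiver.Hom.unop_inj (by simp [← h₂]),
        Quiver.Hom.unop_inj (by simp [← h₁])⟩
    · rintro ⟨b, rfl, rfl⟩
      exact ⟨b.unop.symm, by simp, by simp⟩
  realize_hom X Y Z X' Y' Z' δ δ' x y x' y' a c h h' e := by
    obtain ⟨b, h₁, h₂⟩ := 𝒯.realize_hom δ' δ _ _ _ _ c.unop a.unop h' h e.symm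
    exact ⟨b.op, Quiver.Hom.unop_inj h₂.symm, Quiver.Hom.unop_inj h₁.symm⟩
  exists_sum A B := by
    obtain ⟨S, inl, inr, fst, snd, h₁, h₂, h₃, h₄, h₅, h₆, h₇⟩ := 𝒯.exists_sum A.unop B.unop
    exact ⟨Opposite.op S, fst.op, snd.op, inl.op, inr.op, Quiver.Hom.unop_inj h₁,
      Quiver.Hom.unop_inj h₂, Quiver.Hom.unop_inj h₄, Quiver.Hom.unop_inj h₃,
      Quiver.Hom.unop_inj h₅, h₇, h₆⟩
  et3 X Y Z X' Y' Z' δ δ' x y x' y' a b h h' e := by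
    obtain ⟨c, h₁, h₂⟩ := 𝒯.et3_op δ' δ _ _ _ _ b.unop a.unop h' h
      (Quiver.Hom.op_inj e.symm)
    exact ⟨c.op, Quiver.Hom.unop_inj h₁.symm, h₂.symm⟩
  et3_op X Y Z X' Y' Z' δ δ' x y x' y' b c h h' e := by
    obtain ⟨a, h₁, h₂⟩ := 𝒯.et3 δ' δ _ _ _ _ c.unop b.unop h' h
      (Quiver.Hom.op_inj e.symm)
    exact ⟨a.op, Quiver.Hom.unop_inj h₁.symm, h₂.symm⟩
  et4 A B D G F δ δ' f f' g g' h h' := by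
    obtain ⟨H, d, e, k, δ'', h₁, h₂, h₃, h₄, h₅, h₆⟩ := 𝒯.et4_op δ' δ _ _ _ _ h' h
    exact ⟨Opposite.op H, k.op, e.op, d.op, δ'', h₁, Quiver.Hom.unop_inj h₂.symm,
      Quiver.Hom.unop_inj h₃, h₄, h₅, h₆.symm⟩
  et4_op A B D G F δ δ' f' f g' g h h' := by
    obtain ⟨H, k, d, e, δ'', h₁, h₂, h₃, h₄, h₅, h₆⟩ := 𝒯.et4 δ' δ _ _ _ _ h' h
    exact ⟨Opposite.op H, e.op, d.op, k.op, δ'', h₁, Quiver.Hom.unop_inj h₂.symm,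
      Quiver.Hom.unop_inj h₃, h₄, h₅, h₆.symm⟩

/-! ### Exact sequences attached to a triangle. -/

section Exactness

variable {𝒯} {X Y Z W : C} {δ : 𝒯.Ext Z X} {x : X ⟶ Y} {y : Y ⟶ Z}

lemma push_zero_left (X' : C) (δ : 𝒯.Ext Z X) : 𝒯.push (0 : X ⟶ X') δ = 0 := by
  have := 𝒯.push_add (0 : X ⟶ X') 0 δ
  simpa using this

lemma push_sub (a b : X ⟶ W) (δ : 𝒯.Ext Z X) :
    𝒯.push (a - b) δ = 𝒯.push a δ - 𝒯.push b δ := by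
  rw [eq_sub_iff_add_eq, ← 𝒯.push_add, sub_add_cancel]

lemma pull_zero_left (Z' : C) (δ : 𝒯.Ext Z X) : 𝒯.pull (0 : Z' ⟶ Z) δ = 0 := by
  have := 𝒯.pull_add (0 : Z' ⟶ Z) 0 δ
  simpa using this

lemma Tri.comp_zero (h : 𝒯.Tri δ x y) : x ≫ y = 0 := by
  obtain ⟨S, inl, inr, fst, snd, h₁, h₂, h₃, h₄, h₅, h₆, h₇⟩ := 𝒯.exists_sum X Z
  obtain ⟨c, hc, -⟩ := 𝒯.et3 0 δ inl snd x y (𝟙 X) (fst ≫ x) h₆ h (by simp [reassoc_of% h₁])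
  have := congrArg (inl ≫ ·) hc
  simpa [reassoc_of% h₃, reassoc_of% h₁] using this.symm

lemma Tri.exists_fac (h : 𝒯.Tri δ x y) (u : W ⟶ Y) (hu : u ≫ y = 0) : ∃ a : W ⟶ X, a ≫ x = u := by
  -- The natural comparison is with `W = W ⟶ 0`; since a triangle system has no zero object, the
  -- split triangle on `W ⊕ W` mapping by `0` on the quotient takes its place.
  obtain ⟨S, inl, inr, fst, snd, h₁, h₂, h₃, h₄, h₅, h₆, h₇⟩ := 𝒯.exists_sum W W
  obtain ⟨a, ha, -⟩ := 𝒯.et3_op 0 δ inl snd x y (fst ≫ u) 0 h₆ h (by simp [hu])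
  exact ⟨a, by rw [← ha, reassoc_of% h₁]⟩

lemma Tri.exists_desc (h : 𝒯.Tri δ x y) (u : Y ⟶ W) (hu : x ≫ u = 0) :
    ∃ a : Z ⟶ W, y ≫ a = u := by
  obtain ⟨a, ha⟩ := Tri.exists_fac (𝒯 := 𝒯.op) (δ := δ) (x := y.op) (y := x.op) h u.op
    (Quiver.Hom.unop_inj hu)
  exact ⟨a.unop, Quiver.Hom.op_inj ha⟩

lemma Tri.pull_eq_zero_iff (h : 𝒯.Tri δ x y) (c : W ⟶ Z) :
    𝒯.pull c δ = 0 ↔ ∃ u : W ⟶ Y, u ≫ y = c := by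
  obtain ⟨S, inl, inr, fst, snd, h₁, h₂, h₃, h₄, h₅, h₆, h₇⟩ := 𝒯.exists_sum X W
  constructor
  · intro hc
    obtain ⟨b, hb, hb'⟩ := 𝒯.realize_hom 0 δ inl snd x y (𝟙 X) c h₆ h (by simp [hc])
    exact ⟨inr ≫ b, by rw [Category.assoc, ← hb', reassoc_of% h₂]⟩
  · rintro ⟨u, rfl⟩
    obtain ⟨a, ha, ha'⟩ := 𝒯.et3_op 0 δ inl snd x y (fst ≫ x + snd ≫ u) (u ≫ y) h₆ h
      (by simp [h.comp_zero])
    simpa using ha'.symm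

lemma Tri.push_eq_zero_iff (h : 𝒯.Tri δ x y) (a : X ⟶ W) :
    𝒯.push a δ = 0 ↔ ∃ u : Y ⟶ W, x ≫ u = a := by
  refine (Tri.pull_eq_zero_iff (𝒯 := 𝒯.op) (δ := δ) (x := y.op) (y := x.op) h a.op).trans
    ⟨?_, ?_⟩
  · rintro ⟨u, hu⟩
    exact ⟨u.unop, Quiver.Hom.op_inj hu⟩
  · rintro ⟨u, hu⟩
    exact ⟨u.op, Quiver.Hom.unop_inj hu⟩

lemma Tri.exists_eq_pull (h : 𝒯.Tri δ x y) (γ : 𝒯.Ext W X) (hγ : 𝒯.push x γ = 0) :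
    ∃ c : W ⟶ Z, γ = 𝒯.pull c δ := by
  obtain ⟨B, m, e, hB⟩ := 𝒯.exists_tri γ
  obtain ⟨b, hb⟩ := (hB.push_eq_zero_iff x).1 hγ
  obtain ⟨c, -, hc⟩ := 𝒯.et3 γ δ m e x y (𝟙 X) b hB h (by simp [hb])
  exact ⟨c, by rw [← hc, 𝒯.push_id]⟩

lemma Tri.exists_eq_push (h : 𝒯.Tri δ x y) (γ : 𝒯.Ext Z W) (hγ : 𝒯.pull y γ = 0) :
    ∃ a : X ⟶ W, γ = 𝒯.push a δ := by
  obtain ⟨c, hc⟩ := Tri.exists_eq_pull (𝒯 := 𝒯.op) (δ := δ) (x := y.op) (y := x.op)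
    (W := Opposite.op W) h γ hγ
  exact ⟨c.unop, hc⟩

/-- By (ET4)ᵒᵖ the composite `B ⟶ Y ⟶ Z` has a kernel `H` which extends `X` by `W` with class `pull
x ε = 0`. A retraction `H ⟶ W` pushes the class of that composite to the required extension. -/
lemma Tri.exists_eq_pull_of_pull (h : 𝒯.Tri δ x y) (ε : 𝒯.Ext Y W) (hε : 𝒯.pull x ε = 0) :
    ∃ ε' : 𝒯.Ext Z W, ε = 𝒯.pull y ε' := by
  obtain ⟨B, m, e, hB⟩ := 𝒯.exists_tri ε
  obtain ⟨H, d, k, h', δ'', -, -, -, h₄, -, h₆⟩ := 𝒯.et4_op ε δ m e x y hB h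
  obtain ⟨r, hr⟩ := (h₄.push_eq_zero_iff (𝟙 W)).1 (by rw [hε, map_zero])
  refine ⟨𝒯.push r δ'', ?_⟩
  rw [← 𝒯.push_pull, ← h₆, ← 𝒯.push_comp, hr, 𝒯.push_id]

/-- The difference `φ - 𝟙 Y` factors through `x` and is killed by `x` on the left, so it squares to
zero and `2 - φ` inverts `φ`. -/
lemma isIso_of_endo (h : 𝒯.Tri δ x y) (φ : Y ⟶ Y) (h₁ : x ≫ φ = x) (h₂ : φ ≫ y = y) :
    IsIso φ := by
  obtain ⟨s, hs⟩ := h.exists_fac (φ - 𝟙 Y) (by simp [h₂])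
  have e : (φ - 𝟙 Y) ≫ (φ - 𝟙 Y) = 0 := by
    nth_rewrite 1 [← hs]
    simp [h₁]
  simp only [Preadditive.comp_sub, Preadditive.sub_comp, Category.comp_id, Category.id_comp] at e
  have e' : φ ≫ φ = φ + φ - 𝟙 Y := by
    rw [← sub_eq_zero, ← e]; abel
  refine ⟨𝟙 Y + 𝟙 Y - φ, ?_, ?_⟩ <;>
  · simp only [Preadditive.comp_sub, Preadditive.sub_comp, Category.comp_id, Category.id_comp,
      Preadditive.comp_add, Preadditive.add_comp, e']
    abel

lemma Tri.of_iso (h : 𝒯.Tri δ x y) {X' Y' Z' : C} {x' : X' ⟶ Y'} {y' : Y' ⟶ Z'}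
    (a : X ≅ X') (b : Y ≅ Y') (c : Z ≅ Z') (hx : x ≫ b.hom = a.hom ≫ x')
    (hy : y ≫ c.hom = b.hom ≫ y') : 𝒯.Tri (𝒯.push a.hom (𝒯.pull c.inv δ)) x' y' := by
  obtain ⟨V, p, q, hV⟩ := 𝒯.exists_tri (𝒯.push a.hom (𝒯.pull c.inv δ))
  obtain ⟨φ, hφ, hφ'⟩ := 𝒯.realize_hom _ _ x y p q a.hom c.hom h hV
    (by rw [← 𝒯.push_pull, ← 𝒯.pull_comp, c.hom_inv_id, 𝒯.pull_id])
  obtain ⟨ψ, hψ, hψ'⟩ := 𝒯.realize_hom _ _ p q x y a.inv c.inv hV h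
    (by rw [← 𝒯.push_comp, a.hom_inv_id, 𝒯.push_id])
  have i₁ : IsIso (φ ≫ ψ) := isIso_of_endo h _ (by rw [reassoc_of% hφ, hψ, a.hom_inv_id_assoc])
    (by rw [Category.assoc, ← hψ', ← reassoc_of% hφ', c.hom_inv_id, Category.comp_id])
  have i₂ : IsIso (ψ ≫ φ) := isIso_of_endo hV _
    (by rw [reassoc_of% hψ, hφ, a.inv_hom_id_assoc])
    (by rw [Category.assoc, ← hφ', ← reassoc_of% hψ', c.inv_hom_id, Category.comp_id])
  have i₃ : IsIso φ := by
    have : IsSplitMono φ := ⟨⟨ψ ≫ inv (φ ≫ ψ), by rw [← Category.assoc, IsIso.hom_inv_id]⟩⟩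
    have : Epi φ := epi_of_epi ψ φ
    exact isIso_of_epi_of_isSplitMono φ
  refine (𝒯.tri_iff _ p q x' y' hV).2 ⟨(asIso φ).symm ≪≫ b, ?_, ?_⟩
  · rw [← cancel_epi a.hom, ← hx]
    simp [← reassoc_of% hφ]
  · rw [← cancel_epi φ]
    simp [← hφ', ← hy]

end Exactness

end TriangleSystem

end Extri
-- Homotopy pullbacks and pushouts, Gorenstein objects, and vanishing of extensions.
namespace Extri

namespace TriangleSystem

variable {C : Type u} [Category.{v} C] [Preadditive C] {𝒯 : TriangleSystem.{w} C}

lemma exists_pullback_aux {S M A₁ A₂ B₂ Z : C} {δ : 𝒯.Ext Z S} {j : S ⟶ M} {k : M ⟶ Z}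
    {δ₂ : 𝒯.Ext Z A₂} {x₂ : A₂ ⟶ B₂} {y₂ : B₂ ⟶ Z} (h : 𝒯.Tri δ j k) (h₂ : 𝒯.Tri δ₂ x₂ y₂)
    {inl : A₁ ⟶ S} {inr : A₂ ⟶ S} {fst : S ⟶ A₁} {snd : S ⟶ A₂} (e₁ : inl ≫ fst = 𝟙 A₁)
    (e₂ : inr ≫ snd = 𝟙 A₂) (hS : 𝒯.Tri 0 inl snd) (hδ : 𝒯.push snd δ = δ₂) :
    ∃ e : M ⟶ B₂, 𝒯.Tri (𝒯.pull y₂ (𝒯.push fst δ)) (inl ≫ j) e ∧ e ≫ y₂ = k ∧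
      inr ≫ j ≫ e = x₂ := by
  obtain ⟨H, h', d, e, δ'', k₁, k₂, k₃, k₄, -, k₆⟩ := 𝒯.et4 _ _ _ _ _ _ hS h
  rw [hδ] at k₄
  obtain ⟨b, hb, hb'⟩ := (𝒯.tri_iff _ _ _ _ _ k₄).1 h₂
  refine ⟨h' ≫ b.hom, ?_, by rw [Category.assoc, hb', k₃], ?_⟩
  · have := k₁.of_iso (x' := inl ≫ j) (y' := h' ≫ b.hom) (Iso.refl _) (Iso.refl _) b
      (by simp) (by simp)
    convert this using 1
    simp only [Iso.refl_hom, 𝒯.push_id]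
    have hδ'' : δ'' = 𝒯.pull e (𝒯.push fst δ) := by
      rw [← 𝒯.push_pull, ← k₆, ← 𝒯.push_comp, e₁, 𝒯.push_id]
    rw [hδ'', ← 𝒯.pull_comp, ← hb', b.inv_hom_id_assoc]
  · rw [← Category.assoc j, ← k₂, Category.assoc, reassoc_of% e₂, hb]

/-- `M` is the middle term of the extension of `Z` by `A₁ ⊕ A₂` with components `δ₁`, `δ₂`; by
(ET4), dividing out one summand leaves the middle term of the other triangle. -/
lemma exists_pullback {A₁ B₁ A₂ B₂ Z : C} {δ₁ : 𝒯.Ext Z A₁} {x₁ : A₁ ⟶ B₁} {y₁ : B₁ ⟶ Z}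
    {δ₂ : 𝒯.Ext Z A₂} {x₂ : A₂ ⟶ B₂} {y₂ : B₂ ⟶ Z} (h₁ : 𝒯.Tri δ₁ x₁ y₁)
    (h₂ : 𝒯.Tri δ₂ x₂ y₂) :
    ∃ (M : C) (m₁ : A₁ ⟶ M) (e₁ : M ⟶ B₂) (m₂ : A₂ ⟶ M) (e₂ : M ⟶ B₁),
      𝒯.Tri (𝒯.pull y₂ δ₁) m₁ e₁ ∧ 𝒯.Tri (𝒯.pull y₁ δ₂) m₂ e₂ ∧ m₁ ≫ e₂ = x₁ ∧ m₂ ≫ e₁ = x₂ ∧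
      e₁ ≫ y₂ = e₂ ≫ y₁ := by
  obtain ⟨S, inl, inr, fst, snd, s₁, s₂, s₃, s₄, s₅, s₆, s₇⟩ := 𝒯.exists_sum A₁ A₂
  obtain ⟨M, j, k, h⟩ := 𝒯.exists_tri (𝒯.push inl δ₁ + 𝒯.push inr δ₂)
  have d₁ : 𝒯.push fst (𝒯.push inl δ₁ + 𝒯.push inr δ₂) = δ₁ := by
    rw [map_add, ← 𝒯.push_comp, ← 𝒯.push_comp, s₁, s₄, 𝒯.push_id, push_zero_left, add_zero]
  have d₂ : 𝒯.push snd (𝒯.push inl δ₁ + 𝒯.push inr δ₂) = δ₂ := by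
    rw [map_add, ← 𝒯.push_comp, ← 𝒯.push_comp, s₂, s₃, 𝒯.push_id, push_zero_left, zero_add]
  obtain ⟨e₁, a₁, a₂, a₃⟩ := exists_pullback_aux h h₂ s₁ s₂ s₆ d₂
  obtain ⟨e₂, b₁, b₂, b₃⟩ := exists_pullback_aux h h₁ s₂ s₁ s₇ d₁
  rw [d₁] at a₁
  rw [d₂] at b₁
  exact ⟨M, inl ≫ j, e₁, inr ≫ j, e₂, a₁, b₁, by simpa using b₃, by simpa using a₃,
    by rw [a₂, b₂]⟩

lemma exists_pushout {A B₁ B₂ Z₁ Z₂ : C} {δ₁ : 𝒯.Ext Z₁ A} {x₁ : A ⟶ B₁} {y₁ : B₁ ⟶ Z₁}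
    {δ₂ : 𝒯.Ext Z₂ A} {x₂ : A ⟶ B₂} {y₂ : B₂ ⟶ Z₂} (h₁ : 𝒯.Tri δ₁ x₁ y₁)
    (h₂ : 𝒯.Tri δ₂ x₂ y₂) :
    ∃ (M : C) (m₁ : B₁ ⟶ M) (e₁ : M ⟶ Z₂) (m₂ : B₂ ⟶ M) (e₂ : M ⟶ Z₁),
      𝒯.Tri (𝒯.push x₁ δ₂) m₁ e₁ ∧ 𝒯.Tri (𝒯.push x₂ δ₁) m₂ e₂ ∧ m₁ ≫ e₂ = y₁ ∧ m₂ ≫ e₁ = y₂ ∧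
      x₁ ≫ m₁ = x₂ ≫ m₂ := by
  obtain ⟨M, m₁, e₁, m₂, e₂, k₁, k₂, k₃, k₄, k₅⟩ := exists_pullback (𝒯 := 𝒯.op)
    (δ₁ := δ₁) (x₁ := y₁.op) (y₁ := x₁.op) (δ₂ := δ₂) (x₂ := y₂.op) (y₂ := x₂.op) h₁ h₂
  exact ⟨M.unop, e₂.unop, m₂.unop, e₁.unop, m₁.unop, k₂, k₁, Quiver.Hom.op_inj k₃,
    Quiver.Hom.op_inj k₄, Quiver.Hom.op_inj k₅.symm⟩

/-- `C(W, -)`-exactness of a triangle, where exactness in the middle is automatic. -/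
def Cov (W : C) {X Y Z : C} (x : X ⟶ Y) (y : Y ⟶ Z) : Prop :=
  (∀ u : W ⟶ X, u ≫ x = 0 → u = 0) ∧ ∀ w : W ⟶ Z, ∃ v : W ⟶ Y, v ≫ y = w

/-- `C(-, W)`-exactness of a triangle, where exactness in the middle is automatic. -/
def Contra (W : C) {X Y Z : C} (x : X ⟶ Y) (y : Y ⟶ Z) : Prop :=
  (∀ u : Z ⟶ W, y ≫ u = 0 → u = 0) ∧ ∀ w : X ⟶ W, ∃ v : Y ⟶ W, x ≫ v = w

variable (𝒯)

/-- Projective objects. -/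
def Proj (P : C) : Prop :=
  ∀ ⦃X Y Z : C⦄ (δ : 𝒯.Ext Z X) (x : X ⟶ Y) (y : Y ⟶ Z), 𝒯.Tri δ x y → Cov P x y

/-- Injective objects. -/
def Inj (I : C) : Prop :=
  ∀ ⦃X Y Z : C⦄ (δ : 𝒯.Ext Z X) (x : X ⟶ Y) (y : Y ⟶ Z), 𝒯.Tri δ x y → Contra I x y

/-- Triangles with projective middle term which are `C(-, Q)`-exact for projective `Q`. -/
structure ProjTri {X Y Z : C} (δ : 𝒯.Ext Z X) (x : X ⟶ Y) (y : Y ⟶ Z) : Prop where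
  tri : 𝒯.Tri δ x y
  proj : 𝒯.Proj Y
  contra : ∀ Q, 𝒯.Proj Q → Contra Q x y

/-- Triangles with injective middle term which are `C(J, -)`-exact for injective `J`. -/
structure InjTri {X Y Z : C} (δ : 𝒯.Ext Z X) (x : X ⟶ Y) (y : Y ⟶ Z) : Prop where
  tri : 𝒯.Tri δ x y
  inj : 𝒯.Inj Y
  cov : ∀ J, 𝒯.Inj J → Cov J x y

/-- Classes of objects all of which are syzygies and cosyzygies within the class, with respect to
a given class `R` of triangles. -/
def Complete (R : ∀ ⦃X Y Z : C⦄, 𝒯.Ext Z X → (X ⟶ Y) → (Y ⟶ Z) → Prop) (𝒢 : C → Prop) : Prop :=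
  ∀ A, 𝒢 A →
    (∃ (K P : C) (x : K ⟶ P) (y : P ⟶ A) (δ : 𝒯.Ext A K), 𝒢 K ∧ R δ x y) ∧
    ∃ (P K : C) (x : A ⟶ P) (y : P ⟶ K) (δ : 𝒯.Ext K A), 𝒢 K ∧ R δ x y

/-- Gorenstein projective objects. -/
def GP (A : C) : Prop := ∃ 𝒢 : C → Prop, 𝒯.Complete (fun _ _ _ => 𝒯.ProjTri) 𝒢 ∧ 𝒢 A

/-- Gorenstein injective objects. -/
def GI (A : C) : Prop := ∃ 𝒢 : C → Prop, 𝒯.Complete (fun _ _ _ => 𝒯.InjTri) 𝒢 ∧ 𝒢 A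

/-- Objects `A` such that the triangles of complete projective resolutions are
`C(-, A)`-exact. -/
def ProjTest (A : C) : Prop :=
  ∀ ⦃K P L : C⦄ (x : K ⟶ P) (y : P ⟶ L) (δ : 𝒯.Ext L K), 𝒯.GP K → 𝒯.GP L → 𝒯.ProjTri δ x y →
    Contra A x y

/-- Objects `A` such that the triangles of complete injective coresolutions are
`C(A, -)`-exact. -/
def InjTest (A : C) : Prop :=
  ∀ ⦃K P L : C⦄ (x : K ⟶ P) (y : P ⟶ L) (δ : 𝒯.Ext L K), 𝒯.GI K → 𝒯.GI L → 𝒯.InjTri δ x y →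
    Cov A x y

/-- Objects of finite projective dimension. -/
inductive FP : C → Prop
  | of_proj (P : C) : 𝒯.Proj P → FP P
  | of_tri (K P A : C) (δ : 𝒯.Ext A K) (x : K ⟶ P) (y : P ⟶ A) :
      𝒯.Tri δ x y → 𝒯.Proj P → FP K → FP A

/-- Objects of finite Gorenstein projective dimension. -/
inductive FGP : C → Prop
  | of_gp (G : C) : 𝒯.GP G → FGP G
  | of_tri (K G A : C) (δ : 𝒯.Ext A K) (x : K ⟶ G) (y : G ⟶ A) :
      𝒯.Tri δ x y → 𝒯.GP G → FGP K → FGP A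

/-- Objects of finite Gorenstein injective dimension. -/
inductive FGI : C → Prop
  | of_gi (G : C) : 𝒯.GI G → FGI G
  | of_tri (A G K : C) (δ : 𝒯.Ext K A) (x : A ⟶ G) (y : G ⟶ K) :
      𝒯.Tri δ x y → 𝒯.GI G → FGI K → FGI A

variable {𝒯}

lemma Cov.of_iso {W X Y Z X' Y' Z' : C} {x : X ⟶ Y} {y : Y ⟶ Z} {x' : X' ⟶ Y'} {y' : Y' ⟶ Z'}
    (h : Cov W x y) (a : X ≅ X') (b : Y ≅ Y') (c : Z ≅ Z') (hx : x ≫ b.hom = a.hom ≫ x')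
    (hy : y ≫ c.hom = b.hom ≫ y') : Cov W x' y' := by
  refine ⟨fun u hu => ?_, fun w => ?_⟩
  · have : u ≫ a.inv = 0 := h.1 _ (by
      rw [← cancel_mono b.hom, Category.assoc, Category.assoc, hx, a.inv_hom_id_assoc, hu,
        zero_comp])
    rw [← cancel_mono a.inv, this, zero_comp]
  · obtain ⟨v, hv⟩ := h.2 (w ≫ c.inv)
    exact ⟨v ≫ b.hom, by rw [Category.assoc, ← hy, reassoc_of% hv, c.inv_hom_id, Category.comp_id]⟩

lemma Contra.of_iso {W X Y Z X' Y' Z' : C} {x : X ⟶ Y} {y : Y ⟶ Z} {x' : X' ⟶ Y'}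
    {y' : Y' ⟶ Z'} (h : Contra W x y) (a : X ≅ X') (b : Y ≅ Y') (c : Z ≅ Z')
    (hx : x ≫ b.hom = a.hom ≫ x') (hy : y ≫ c.hom = b.hom ≫ y') : Contra W x' y' := by
  refine ⟨fun u hu => ?_, fun w => ?_⟩
  · have : c.hom ≫ u = 0 := h.1 _ (by rw [reassoc_of% hy, hu, comp_zero])
    rw [← cancel_epi c.hom, this, comp_zero]
  · obtain ⟨v, hv⟩ := h.2 (a.hom ≫ w)
    refine ⟨b.inv ≫ v, ?_⟩
    rw [← cancel_epi a.hom, ← reassoc_of% hx, b.hom_inv_id_assoc, hv]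

lemma ProjTri.of_iso {X Y Z X' Z' : C} {δ : 𝒯.Ext Z X} {x : X ⟶ Y} {y : Y ⟶ Z}
    (h : 𝒯.ProjTri δ x y) (a : X ≅ X') (c : Z ≅ Z') :
    𝒯.ProjTri (𝒯.push a.hom (𝒯.pull c.inv δ)) (a.inv ≫ x) (y ≫ c.hom) :=
  ⟨h.tri.of_iso a (Iso.refl _) c (by simp) (by simp), h.proj,
    fun Q hQ => (h.contra Q hQ).of_iso a (Iso.refl _) c (by simp) (by simp)⟩

lemma InjTri.of_iso {X Y Z X' Z' : C} {δ : 𝒯.Ext Z X} {x : X ⟶ Y} {y : Y ⟶ Z}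
    (h : 𝒯.InjTri δ x y) (a : X ≅ X') (c : Z ≅ Z') :
    𝒯.InjTri (𝒯.push a.hom (𝒯.pull c.inv δ)) (a.inv ≫ x) (y ≫ c.hom) :=
  ⟨h.tri.of_iso a (Iso.refl _) c (by simp) (by simp), h.inj,
    fun Q hQ => (h.cov Q hQ).of_iso a (Iso.refl _) c (by simp) (by simp)⟩

lemma GP.exists_left {A : C} (hA : 𝒯.GP A) :
    ∃ (K P : C) (x : K ⟶ P) (y : P ⟶ A) (δ : 𝒯.Ext A K), 𝒯.GP K ∧ 𝒯.ProjTri δ x y := by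
  obtain ⟨𝒢, h𝒢, hA⟩ := hA
  obtain ⟨K, P, x, y, δ, hK, h⟩ := (h𝒢 A hA).1
  exact ⟨K, P, x, y, δ, ⟨𝒢, h𝒢, hK⟩, h⟩

lemma GP.exists_right {A : C} (hA : 𝒯.GP A) :
    ∃ (P K : C) (x : A ⟶ P) (y : P ⟶ K) (δ : 𝒯.Ext K A), 𝒯.GP K ∧ 𝒯.ProjTri δ x y := by
  obtain ⟨𝒢, h𝒢, hA⟩ := hA
  obtain ⟨K, P, x, y, δ, hK, h⟩ := (h𝒢 A hA).2
  exact ⟨K, P, x, y, δ, ⟨𝒢, h𝒢, hK⟩, h⟩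

lemma GI.exists_left {A : C} (hA : 𝒯.GI A) :
    ∃ (K P : C) (x : K ⟶ P) (y : P ⟶ A) (δ : 𝒯.Ext A K), 𝒯.GI K ∧ 𝒯.InjTri δ x y := by
  obtain ⟨𝒢, h𝒢, hA⟩ := hA
  obtain ⟨K, P, x, y, δ, hK, h⟩ := (h𝒢 A hA).1
  exact ⟨K, P, x, y, δ, ⟨𝒢, h𝒢, hK⟩, h⟩

lemma Proj.ext_eq_zero {P : C} (hP : 𝒯.Proj P) {X : C} (δ : 𝒯.Ext P X) : δ = 0 := by
  obtain ⟨Y, x, y, h⟩ := 𝒯.exists_tri δ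
  have := (h.pull_eq_zero_iff (𝟙 P)).2 ((hP δ x y h).2 _)
  rwa [𝒯.pull_id] at this

lemma Inj.ext_eq_zero {I : C} (hI : 𝒯.Inj I) {Z : C} (δ : 𝒯.Ext Z I) : δ = 0 := by
  obtain ⟨Y, x, y, h⟩ := 𝒯.exists_tri δ
  have := (h.push_eq_zero_iff (𝟙 I)).2 ((hI δ x y h).2 _)
  rwa [𝒯.push_id] at this

lemma Proj.projTest {Q : C} (hQ : 𝒯.Proj Q) : 𝒯.ProjTest Q :=
  fun _ _ _ _ _ _ _ _ h => h.contra Q hQ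

/-- Over the projective cover term `P` of `W` the extension vanishes, so it is pushed forward from
the syzygy along some `γ`; the test property extends `γ` to `P`. -/
lemma ProjTest.ext_eq_zero {A W : C} (hA : 𝒯.ProjTest A) (hW : 𝒯.GP W) (θ : 𝒯.Ext W A) :
    θ = 0 := by
  obtain ⟨K, P, x, y, δ, hK, h⟩ := hW.exists_left
  obtain ⟨γ, rfl⟩ := h.tri.exists_eq_push θ (h.proj.ext_eq_zero _)
  exact (h.tri.push_eq_zero_iff γ).2 ((hA x y δ hK hW h).2 γ)

lemma ProjTest.cov {A' B Z W : C} {δ : 𝒯.Ext Z A'} {x : A' ⟶ B} {y : B ⟶ Z}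
    (hA : 𝒯.ProjTest A') (h : 𝒯.Tri δ x y) (hW : 𝒯.GP W) : Cov W x y := by
  refine ⟨fun u hu => ?_, fun c => (h.pull_eq_zero_iff c).1 (hA.ext_eq_zero hW _)⟩
  obtain ⟨K, P, p, q, ε, hK, hP⟩ := hW.exists_left
  exact (hA p q ε hK hW hP).1 u ((hP.proj δ x y h).1 _ (by simp [hu]))

/-- Induction step on projective dimension. Deflations need not be epimorphisms, so the injectivity
half of exactness needs its own diagram chase. -/
lemma ProjTest.of_tri {A' Q A : C} {δ : 𝒯.Ext A A'} {x : A' ⟶ Q} {y : Q ⟶ A}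
    (h : 𝒯.Tri δ x y) (hA : 𝒯.ProjTest A') (hQ : 𝒯.ProjTest Q) : 𝒯.ProjTest A := by
  intro K P L g f ε hK hL hP
  refine ⟨fun α hα => ?_, fun γ => ?_⟩
  · obtain ⟨β, rfl⟩ := (hA.cov h hL).2 α
    obtain ⟨γ, hγ⟩ := h.exists_fac (f ≫ β) (by rw [Category.assoc, hα])
    have h₁ : g ≫ γ = 0 := (hA.cov h hK).1 _ (by
      rw [Category.assoc, hγ, reassoc_of% hP.tri.comp_zero, zero_comp])
    obtain ⟨t, rfl⟩ := hP.tri.exists_desc γ h₁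
    have h₂ : β - t ≫ x = 0 := (hQ g f ε hK hL hP).1 _ (by
      rw [Preadditive.comp_sub, ← hγ, Category.assoc, sub_self])
    rw [sub_eq_zero.1 h₂, Category.assoc, h.comp_zero, comp_zero]
  · obtain ⟨β, rfl⟩ := (hA.cov h hK).2 γ
    obtain ⟨t, rfl⟩ := (hQ g f ε hK hL hP).2 β
    exact ⟨t ≫ y, by simp⟩

lemma FP.projTest {A : C} (hA : 𝒯.FP A) : 𝒯.ProjTest A := by
  induction hA with
  | of_proj P hP => exact hP.projTest
  | of_tri K P A δ x y h hP _ ih => exact .of_tri h ih hP.projTest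

lemma Proj.injTest {P : C} (hP : 𝒯.Proj P) : 𝒯.InjTest P :=
  fun _ _ _ x y δ _ _ h => hP δ x y h.tri

lemma InjTest.of_tri {F' Q F : C} {δ : 𝒯.Ext F F'} {x : F' ⟶ Q} {y : Q ⟶ F}
    (h : 𝒯.Tri δ x y) (hF : 𝒯.InjTest F') (hQ : 𝒯.Proj Q) : 𝒯.InjTest F := by
  -- Extensions of `F` by a Gorenstein injective `E` vanish: such an extension comes from a map `F'
  -- ⟶ E`, which lifts to an injective, and extensions by an injective are zero.
  have key : ∀ {E : C}, 𝒯.GI E → ∀ ε : 𝒯.Ext F E, ε = 0 := by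
    intro E hE ε
    obtain ⟨E', I, p, q, η, hE', hI⟩ := hE.exists_left
    obtain ⟨γ, rfl⟩ := h.exists_eq_push ε (hQ.ext_eq_zero _)
    obtain ⟨γ, rfl⟩ := (hF p q η hE' hE hI).2 γ
    rw [𝒯.push_comp, hI.inj.ext_eq_zero (𝒯.push γ δ), map_zero]
  intro K I L g f ε hK hL hI
  refine ⟨fun u hu => ?_, fun c => (hI.tri.pull_eq_zero_iff c).1 (key hK _)⟩
  obtain ⟨E, J, p, q, η, hE, hJ⟩ := hK.exists_left
  have h₁ : y ≫ u = 0 := (hQ ε g f hI.tri).1 _ (by rw [Category.assoc, hu, comp_zero])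
  obtain ⟨u', rfl⟩ := (hJ.tri.pull_eq_zero_iff u).1 (key hE _)
  obtain ⟨t, ht⟩ := hJ.tri.exists_fac (y ≫ u') (by rw [Category.assoc, h₁])
  have h₂ : x ≫ t = 0 := (hF p q η hE hK hJ).1 _ (by
    rw [Category.assoc, ht, reassoc_of% h.comp_zero, zero_comp])
  obtain ⟨t, rfl⟩ := h.exists_desc t h₂
  have h₃ : u' - t ≫ p = 0 := (hJ.inj δ x y h).1 _ (by
    rw [Preadditive.comp_sub, ← ht, Category.assoc, sub_self])
  rw [sub_eq_zero.1 h₃, Category.assoc, hJ.tri.comp_zero, comp_zero]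

lemma FP.injTest {A : C} (hA : 𝒯.FP A) : 𝒯.InjTest A := by
  induction hA with
  | of_proj P hP => exact hP.injTest
  | of_tri K P A δ x y h hP _ ih => exact .of_tri h ih hP

/-- A map `F ⟶ E` lifts to the injective `I` covering `E`, extends from there to `G`, and is
composed back down to `E`. Injectivity uses the same property for the syzygy of `E`. -/
lemma InjTest.contra {F G M E : C} {δ : 𝒯.Ext M F} {g : F ⟶ G} {f : G ⟶ M}
    (hF : 𝒯.InjTest F) (h : 𝒯.Tri δ g f) (hE : 𝒯.GI E) : Contra E g f := by
  have surj : ∀ {E : C}, 𝒯.GI E → ∀ w : F ⟶ E, ∃ v, g ≫ v = w := fun hE w => by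
    obtain ⟨E', I, x, q, η, hE', hI⟩ := hE.exists_left
    obtain ⟨w, rfl⟩ := (hF x q η hE' hE hI).2 w
    obtain ⟨v, rfl⟩ := (hI.inj δ g f h).2 w
    exact ⟨v ≫ q, by simp⟩
  refine ⟨fun φ hφ => ?_, surj hE⟩
  obtain ⟨E', I, x, q, η, hE', hI⟩ := hE.exists_left
  have h₀ : 𝒯.pull φ η = 0 := by
    obtain ⟨γ, hγ⟩ := h.exists_eq_push (𝒯.pull φ η) (by
      rw [← 𝒯.pull_comp, hφ, pull_zero_left])
    rw [hγ]
    exact (h.push_eq_zero_iff γ).2 (surj hE' γ)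
  obtain ⟨φ, rfl⟩ := (hI.tri.pull_eq_zero_iff φ).1 h₀
  obtain ⟨t, ht⟩ := hI.tri.exists_fac (f ≫ φ) (by rw [Category.assoc, hφ])
  have h₂ : g ≫ t = 0 := (hF x q η hE' hE hI).1 _ (by
    rw [Category.assoc, ht, reassoc_of% h.comp_zero, zero_comp])
  obtain ⟨t, rfl⟩ := h.exists_desc t h₂
  have h₃ : φ - t ≫ x = 0 := (hI.inj δ g f h).1 _ (by
    rw [Preadditive.comp_sub, ← ht, Category.assoc, sub_self])
  rw [sub_eq_zero.1 h₃, Category.assoc, hI.tri.comp_zero, comp_zero]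

end TriangleSystem

end Extri
-- Extension closure of Gorenstein projectives, approximations, and arbitrary resolutions.
namespace Extri

namespace TriangleSystem

variable {C : Type u} [Category.{v} C] [Preadditive C] {𝒯 : TriangleSystem.{w} C}

lemma Proj.of_tri {P W P' : C} {δ : 𝒯.Ext P' P} {p : P ⟶ W} {q : W ⟶ P'} (h : 𝒯.Tri δ p q)
    (hP : 𝒯.Proj P) (hP' : 𝒯.Proj P') : 𝒯.Proj W := by
  intro X Y Z ε x y hε
  obtain ⟨s, hs⟩ := (hP' δ p q h).2 (𝟙 P')
  refine ⟨fun u hu => ?_, fun c => ?_⟩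
  · obtain ⟨t, rfl⟩ := h.exists_desc u
      ((hP ε x y hε).1 _ (by rw [Category.assoc, hu, comp_zero]))
    have := (hP' ε x y hε).1 t (by
      have := s ≫= hu
      rwa [Category.assoc, reassoc_of% hs, comp_zero] at this)
    rw [this, comp_zero]
  · obtain ⟨v, hv⟩ := (hP ε x y hε).2 (p ≫ c)
    obtain ⟨v, rfl⟩ := (h.push_eq_zero_iff v).1 (by rw [hP'.ext_eq_zero δ, map_zero])
    obtain ⟨t, ht⟩ := h.exists_desc (c - v ≫ y) (by
      rw [Preadditive.comp_sub, ← hv, Category.assoc, sub_self])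
    obtain ⟨t, rfl⟩ := (hP' ε x y hε).2 t
    exact ⟨v + q ≫ t, by rw [Preadditive.add_comp, Category.assoc, ht, add_sub_cancel]⟩

lemma Proj.gp {P : C} (hP : 𝒯.Proj P) : 𝒯.GP P := by
  refine ⟨𝒯.Proj, fun Q hQ => ?_, hP⟩
  obtain ⟨S, inl, inr, fst, snd, h₁, h₂, h₃, h₄, h₅, h₆, h₇⟩ := 𝒯.exists_sum Q Q
  have h : 𝒯.ProjTri 0 inl snd := ⟨h₆, .of_tri h₆ hQ hQ, fun R _ =>
    ⟨fun u hu => by simpa [reassoc_of% h₂] using inr ≫= hu,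
      fun w => ⟨fst ≫ w, by rw [reassoc_of% h₁]⟩⟩⟩
  exact ⟨⟨Q, S, inl, snd, 0, hQ, h⟩, ⟨S, Q, inl, snd, 0, hQ, h⟩⟩

/-- Horseshoe lemma on the coresolution side: the new middle term is `P ⊕ P'`, and the cosyzygy of
`X` is again an extension of Gorenstein projectives. -/
lemma GP.exists_right_of_tri {G X G' : C} {θ : 𝒯.Ext G' G} {i : G ⟶ X} {j : X ⟶ G'}
    (h : 𝒯.Tri θ i j) (hG : 𝒯.GP G) (hG' : 𝒯.GP G') :
    ∃ (W X₁ : C) (x : X ⟶ W) (y : W ⟶ X₁) (δ : 𝒯.Ext X₁ X),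
      (∃ (G₁ G₁' : C) (θ₁ : 𝒯.Ext G₁' G₁) (i₁ : G₁ ⟶ X₁) (j₁ : X₁ ⟶ G₁'),
        𝒯.GP G₁ ∧ 𝒯.GP G₁' ∧ 𝒯.Tri θ₁ i₁ j₁) ∧ 𝒯.ProjTri δ x y := by
  obtain ⟨P, G₁, x, y, δ₁, hG₁, hP⟩ := hG.exists_right
  obtain ⟨P', G₁', x', y', δ₂, hG₁', hP'⟩ := hG'.exists_right
  obtain ⟨M, m₁, e₁, m₂, e₂, k₁, k₂, -, k₄, -⟩ := exists_pushout h hP.tri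
  rw [hP.proj.projTest.ext_eq_zero hG' (𝒯.push x θ)] at k₂
  obtain ⟨W, p, q, hW⟩ := 𝒯.exists_tri (0 : 𝒯.Ext P' P)
  obtain ⟨H, d, e, h', δ'', t₁, -, -, t₄, -, -⟩ := 𝒯.et4_op _ _ _ _ _ _ hW hP'.tri
  rw [map_zero] at t₄
  -- Both the pushout `M` and the kernel `H` of `W ⟶ P' ⟶ G₁'` realize the zero extension of `G'` by
  -- `P`, hence agree. So `X ⟶ M ⟶ W` is a composite of inflations, to which (ET4) applies.
  obtain ⟨b, -, -⟩ := (𝒯.tri_iff _ _ _ _ _ k₂).1 t₄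
  have hM := t₁.of_iso (x' := b.hom ≫ h') (y' := q ≫ y') b.symm (Iso.refl _) (Iso.refl _)
    (by simp) (by simp)
  obtain ⟨X₁, c, d', e', δ₃, s₁, s₂, s₃, s₄, -, -⟩ := 𝒯.et4 _ _ _ _ _ _ k₁ hM
  refine ⟨W, X₁, _, _, δ₃, ⟨G₁, G₁', _, d', e', hG₁, hG₁', s₄⟩, s₁, .of_tri hW hP.proj hP'.proj,
    fun Q hQ => ⟨fun φ hφ => ?_, fun w => ?_⟩⟩
  · have h₁ : d' ≫ φ = 0 := (hP.contra Q hQ).1 _ (by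
      rw [← k₄, Category.assoc, reassoc_of% s₂, hφ]; simp)
    obtain ⟨φ, rfl⟩ := s₄.exists_desc φ h₁
    obtain ⟨s, hs⟩ := (hP'.proj _ _ _ hW).2 (𝟙 P')
    have h₂ : φ = 0 := (hP'.contra Q hQ).1 _ (by
      rw [reassoc_of% s₃] at hφ
      have := s ≫= hφ
      rwa [reassoc_of% hs, comp_zero] at this)
    rw [h₂, comp_zero]
  · obtain ⟨v, rfl⟩ := (k₁.push_eq_zero_iff w).1 (hQ.projTest.ext_eq_zero hG₁ _)
    obtain ⟨v, rfl⟩ := (hM.push_eq_zero_iff v).1 (hQ.projTest.ext_eq_zero hG₁' _)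
    exact ⟨v, by simp⟩

/-- Horseshoe lemma on the resolution side: `P ⊕ P' ⟶ G ⊕ P' ⟶ X` is a composite of deflations, the
middle object being the pullback of `X` and `P'` over `G'`. -/
lemma GP.exists_left_of_tri {G X G' : C} {θ : 𝒯.Ext G' G} {i : G ⟶ X} {j : X ⟶ G'}
    (h : 𝒯.Tri θ i j) (hG : 𝒯.GP G) (hG' : 𝒯.GP G') :
    ∃ (X₁ W : C) (x : X₁ ⟶ W) (y : W ⟶ X) (δ : 𝒯.Ext X X₁),
      (∃ (G₁ G₁' : C) (θ₁ : 𝒯.Ext G₁' G₁) (i₁ : G₁ ⟶ X₁) (j₁ : X₁ ⟶ G₁'),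
        𝒯.GP G₁ ∧ 𝒯.GP G₁' ∧ 𝒯.Tri θ₁ i₁ j₁) ∧ 𝒯.ProjTri δ x y := by
  obtain ⟨G₁, P, x, y, δ₁, hG₁, hP⟩ := hG.exists_left
  obtain ⟨G₁', P', x', y', δ₂, hG₁', hP'⟩ := hG'.exists_left
  obtain ⟨M, m₁, e₁, m₂, e₂, k₁, k₂, k₃, -, k₅⟩ := exists_pullback h hP'.tri
  rw [hP'.proj.ext_eq_zero (𝒯.pull y' θ)] at k₁
  obtain ⟨W, p, q, hW⟩ := 𝒯.exists_tri (0 : 𝒯.Ext P' P)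
  obtain ⟨H, h', d, e, δ'', t₁, t₂, t₃, t₄, -, -⟩ := 𝒯.et4 _ _ _ _ _ _ hP.tri hW
  rw [map_zero] at t₄
  obtain ⟨b, b₁, b₂⟩ := (𝒯.tri_iff _ _ _ _ _ t₄).1 k₁
  have hM := t₁.of_iso (x' := x ≫ p) (y' := h' ≫ b.hom) (Iso.refl _) (Iso.refl _) b
    (by simp) (by simp)
  obtain ⟨X₁, k, l, h'', δ₃, s₁, -, -, s₄, -, -⟩ := 𝒯.et4_op _ _ _ _ _ _ hM k₂
  refine ⟨X₁, W, _, _, δ₃, ⟨G₁, G₁', _, k, l, hG₁, hG₁', s₄⟩, s₁, .of_tri hW hP.proj hP'.proj,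
    fun Q hQ => ⟨fun φ hφ => ?_, fun w => (s₁.push_eq_zero_iff w).1 ?_⟩⟩
  · have h₁ : i ≫ φ = 0 := (hP.contra Q hQ).1 _ (by
      rw [← k₃, ← b₁]
      have := p ≫= hφ
      simpa [reassoc_of% t₂] using this)
    obtain ⟨φ, rfl⟩ := h.exists_desc φ h₁
    obtain ⟨s, hs⟩ := (hP'.proj _ _ _ hW).2 (𝟙 P')
    have h₂ : φ = 0 := (hP'.contra Q hQ).1 _ (by
      have := s ≫= hφ
      simpa [← reassoc_of% k₅, reassoc_of% b₂, reassoc_of% t₃, reassoc_of% hs] using this)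
    rw [h₂, comp_zero]
  -- The obstruction lies in the extensions of `X` by `Q`, which vanish because those of `G` and of
  -- `G'` do.
  · obtain ⟨ε, hε⟩ := h.exists_eq_pull_of_pull (𝒯.push w δ₃) (hQ.projTest.ext_eq_zero hG _)
    rw [hε, hQ.projTest.ext_eq_zero hG' ε, map_zero]

/-- By the two horseshoe lemmas, the class of all extensions of Gorenstein projectives by one
another is itself complete. -/
lemma GP.of_tri {G X G' : C} {θ : 𝒯.Ext G' G} {i : G ⟶ X} {j : X ⟶ G'}
    (h : 𝒯.Tri θ i j) (hG : 𝒯.GP G) (hG' : 𝒯.GP G') : 𝒯.GP X := by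
  refine ⟨fun X => ∃ (G G' : C) (θ : 𝒯.Ext G' G) (i : G ⟶ X) (j : X ⟶ G'),
    𝒯.GP G ∧ 𝒯.GP G' ∧ 𝒯.Tri θ i j, ?_, G, G', θ, i, j, hG, hG', h⟩
  rintro X ⟨G, G', θ, i, j, hG, hG', h⟩
  exact ⟨GP.exists_left_of_tri h hG hG', GP.exists_right_of_tri h hG hG'⟩

lemma FP.fgp {A : C} (hA : 𝒯.FP A) : 𝒯.FGP A := by
  induction hA with
  | of_proj P hP => exact .of_gp P hP.gp
  | of_tri K P A δ x y h hP _ ih => exact .of_tri K P A δ x y h hP.gp ih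

/-- Objects of finite Gorenstein projective dimension have Gorenstein projective approximations
with kernel of finite projective dimension. -/
lemma FGP.exists_approx (hP : ∃ P, 𝒯.Proj P) {M : C} (hM : 𝒯.FGP M) :
    ∃ (K G : C) (x : K ⟶ G) (y : G ⟶ M) (δ : 𝒯.Ext M K), 𝒯.FP K ∧ 𝒯.GP G ∧ 𝒯.Tri δ x y := by
  induction hM with
  | of_gp G hG =>
    obtain ⟨P, hP⟩ := hP
    obtain ⟨S, inl, inr, fst, snd, h₁, h₂, h₃, h₄, h₅, h₆, h₇⟩ := 𝒯.exists_sum P G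
    exact ⟨P, S, inl, snd, 0, .of_proj P hP, .of_tri h₆ hP.gp hG, h₆⟩
  | of_tri K G A δ x y h hG _ ih =>
    -- Auslander–Buchweitz construction: the approximation of `K` yields `K' ⟶ P ⟶ H` and `K ⟶ H ⟶
    -- G''`, so `H` has finite projective dimension. The pushout `M` of `G` and `H` over `K` is an
    -- extension of `G''` by `G` and surjects onto `A` with kernel `H`.
    obtain ⟨K', G', x', y', δ', hK', hG', h'⟩ := ih
    obtain ⟨P, G'', p, q, ε, hG'', hP⟩ := hG'.exists_right
    obtain ⟨H, c, d, e, δ'', t₁, -, -, t₄, -, -⟩ := 𝒯.et4 _ _ _ _ _ _ h' hP.tri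
    obtain ⟨M, m₁, e₁, m₂, e₂, k₁, k₂, -, -, -⟩ := exists_pushout h t₄
    exact ⟨H, M, m₂, e₂, _, .of_tri _ _ _ _ _ _ t₁ hP.proj hK', .of_tri k₁ hG hG'', k₂⟩

variable (𝒯) in
/-- Endomorphisms which are sums of morphisms factoring through objects of finite Gorenstein
projective dimension. -/
inductive FactorsFGP {M : C} : (M ⟶ M) → Prop
  | of_fac (L : C) (i : M ⟶ L) (r : L ⟶ M) : 𝒯.FGP L → FactorsFGP (i ≫ r)
  | add (φ ψ : M ⟶ M) : FactorsFGP φ → FactorsFGP ψ → FactorsFGP (φ + ψ)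

/-- An endomorphism through `L` lifts through the approximation `F ⟶ G' ⟶ L`, so on syzygies it
factors through `F`, which has finite projective dimension. Exactness for Gorenstein injectives is
thus borrowed from the approximation, and all conclusions are additive. -/
lemma FactorsFGP.exists_syzygy (hP : ∃ P, 𝒯.Proj P) {K G M : C} {δ : 𝒯.Ext M K} {g : K ⟶ G}
    {f : G ⟶ M} (h : 𝒯.Tri δ g f) (hG : 𝒯.GP G) (hf : ∀ W, 𝒯.GP W → Cov W g f)
    {φ : M ⟶ M} (hφ : 𝒯.FactorsFGP φ) :
    (∀ (E : C), 𝒯.GI E → ∀ u : M ⟶ E, f ≫ u = 0 → φ ≫ u = 0) ∧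
      ∃ ψ : K ⟶ K, 𝒯.FactorsFGP ψ ∧ 𝒯.push ψ δ = 𝒯.pull φ δ ∧
        ∀ (E : C), 𝒯.GI E → ∀ w : K ⟶ E, ∃ v : G ⟶ E, g ≫ v = ψ ≫ w := by
  induction hφ with
  | of_fac L i r hL =>
    obtain ⟨F, G', g', f', δ', hF, hG', h'⟩ := hL.exists_approx hP
    -- Both lifts exist because `G` and `G'` are Gorenstein projective and both triangles are `C(𝒢𝒫,
    -- -)`-exact.
    obtain ⟨u, hu⟩ := (hF.projTest.cov h' hG).2 (f ≫ i)
    obtain ⟨v, hv⟩ := (hf G' hG').2 (f' ≫ r)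
    obtain ⟨a, ha, ha'⟩ := 𝒯.et3_op _ _ _ _ _ _ u i h h' hu.symm
    obtain ⟨b, hb, hb'⟩ := 𝒯.et3_op _ _ _ _ _ _ v r h' h hv.symm
    refine ⟨fun E hE t ht => ?_, a ≫ b, .of_fac F a b hF.fgp, ?_, fun E hE w => ?_⟩
    · rw [Category.assoc, (hF.injTest.contra h' hE).1 (r ≫ t) (by
        rw [← reassoc_of% hv, ht, comp_zero]), comp_zero]
    · rw [𝒯.push_comp, ha', 𝒯.push_pull, hb', 𝒯.pull_comp]
    · obtain ⟨t, ht⟩ := (hF.injTest.contra h' hE).2 (b ≫ w)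
      exact ⟨u ≫ t, by rw [reassoc_of% ha, ht, Category.assoc]⟩
  | add φ φ' _ _ ih ih' =>
    obtain ⟨h₁, ψ, hψ, h₂, h₃⟩ := ih
    obtain ⟨h₁', ψ', hψ', h₂', h₃'⟩ := ih'
    refine ⟨fun E hE u hu => ?_, ψ + ψ', .add _ _ hψ hψ', ?_, fun E hE w => ?_⟩
    · rw [Preadditive.add_comp, h₁ E hE u hu, h₁' E hE u hu, add_zero]
    · rw [𝒯.push_add, 𝒯.pull_add, h₂, h₂']
    · obtain ⟨v, hv⟩ := h₃ E hE w
      obtain ⟨v', hv'⟩ := h₃' E hE w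
      exact ⟨v + v', by rw [Preadditive.comp_add, Preadditive.add_comp, hv, hv']⟩

lemma FactorsFGP.contra (hP : ∃ P, 𝒯.Proj P) {K G M : C} {δ : 𝒯.Ext M K} {g : K ⟶ G}
    {f : G ⟶ M} (h : 𝒯.Tri δ g f) (hG : 𝒯.GP G) (hf : ∀ W, 𝒯.GP W → Cov W g f)
    (hM : 𝒯.FactorsFGP (𝟙 M)) :
    𝒯.FactorsFGP (𝟙 K) ∧ ∀ E, 𝒯.GI E → Contra E g f := by
  obtain ⟨h₁, ψ, hψ, h₂, h₃⟩ := hM.exists_syzygy hP h hG hf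
  -- As `ψ` lies over `𝟙 M`, the map `𝟙 K - ψ` kills `δ` and so factors through `g`. Hence `𝟙 K` is
  -- `ψ` plus a map through the Gorenstein projective `G`, and the invariant passes to `K`.
  obtain ⟨s, hs⟩ := (h.push_eq_zero_iff (𝟙 K - ψ)).1 (by
    rw [push_sub, h₂, 𝒯.push_id, 𝒯.pull_id, sub_self])
  have e : 𝟙 K = ψ + g ≫ s := by rw [hs, add_sub_cancel]
  refine ⟨e ▸ .add _ _ hψ (.of_fac G g s (.of_gp G hG)), fun E hE =>
    ⟨fun u hu => by simpa using h₁ E hE u hu, fun w => ?_⟩⟩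
  obtain ⟨v, hv⟩ := h₃ E hE w
  refine ⟨v + s ≫ w, ?_⟩
  rw [Preadditive.comp_add, hv, ← Category.assoc g, ← Preadditive.add_comp, ← e, Category.id_comp]

lemma FGP.contra_resolution (hP : ∃ P, 𝒯.Proj P) (K G : ℕ → C) (hM : 𝒯.FGP (K 0))
    (δ : ∀ i, 𝒯.Ext (K i) (K (i + 1))) (g : ∀ i, K (i + 1) ⟶ G i) (f : ∀ i, G i ⟶ K i)
    (h : ∀ i, 𝒯.Tri (δ i) (g i) (f i)) (hG : ∀ i, 𝒯.GP (G i))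
    (hf : ∀ i W, 𝒯.GP W → Cov W (g i) (f i)) (i : ℕ) (E : C) (hE : 𝒯.GI E) :
    Contra E (g i) (f i) := by
  have key : ∀ i, 𝒯.FactorsFGP (𝟙 (K i)) := fun i => by
    induction i with
    | zero => simpa using FactorsFGP.of_fac (K 0) (𝟙 _) (𝟙 _) hM
    | succ i ih => exact (ih.contra hP (h i) (hG i) (hf i)).1
  exact ((key i).contra hP (h i) (hG i) (hf i)).2 E hE

end TriangleSystem

end Extri
-- Unbounded families of triangles and passage to the opposite.
namespace Extri

namespace TriangleSystem

variable {C : Type u} [Category.{v} C] [Preadditive C] {𝒯 : TriangleSystem.{w} C}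

/-- A complete class of objects yields unbounded families of triangles. -/
lemma Complete.exists_family {R : ∀ ⦃X Y Z : C⦄, 𝒯.Ext Z X → (X ⟶ Y) → (Y ⟶ Z) → Prop}
    {𝒢 : C → Prop} (h : 𝒯.Complete R 𝒢) {A : C} (hA : 𝒢 A) :
    ∃ (K X : ℤ → C) (g : ∀ n, K (n + 1) ⟶ X n) (f : ∀ n, X n ⟶ K n)
      (δ : ∀ n, 𝒯.Ext (K n) (K (n + 1))), (∀ n, R (δ n) (g n) (f n)) ∧ K 0 = A := by
  have hl : ∀ A : {A // 𝒢 A}, ∃ K : {A // 𝒢 A}, ∃ (P : C) (x : K.1 ⟶ P) (y : P ⟶ A.1)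
      (δ : 𝒯.Ext A.1 K.1), R δ x y := fun A => by
    obtain ⟨K, P, x, y, δ, hK, h⟩ := (h A.1 A.2).1
    exact ⟨⟨K, hK⟩, P, x, y, δ, h⟩
  have hr : ∀ A : {A // 𝒢 A}, ∃ K : {A // 𝒢 A}, ∃ (P : C) (x : A.1 ⟶ P) (y : P ⟶ K.1)
      (δ : 𝒯.Ext K.1 A.1), R δ x y := fun A => by
    obtain ⟨P, K, x, y, δ, hK, h⟩ := (h A.1 A.2).2
    exact ⟨⟨K, hK⟩, P, x, y, δ, h⟩
  choose L hL using hl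
  choose U hU using hr
  let KL : ℕ → {A // 𝒢 A} := fun n => Nat.rec ⟨A, hA⟩ (fun _ => L) n
  let KU : ℕ → {A // 𝒢 A} := fun n => Nat.rec (U ⟨A, hA⟩) (fun _ => U) n
  let K : ℤ → {A // 𝒢 A} := fun n => match n with
    | Int.ofNat n => KL n
    | Int.negSucc n => KU n
  have hK : ∀ n : ℤ, ∃ (P : C) (x : (K (n + 1)).1 ⟶ P) (y : P ⟶ (K n).1)
      (δ : 𝒯.Ext (K n).1 (K (n + 1)).1), R δ x y := fun n => match n with
    | Int.ofNat n => hL (KL n)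
    -- At index `-1` the two halves meet: the triangle runs from `K 0 = A` to its first cosyzygy.
    | Int.negSucc 0 => hU ⟨A, hA⟩
    | Int.negSucc (n + 1) => hU (KU n)
  choose X g f δ hδ using hK
  exact ⟨fun n => (K n).1, X, g, f, δ, hδ, rfl⟩

lemma complete_of_family {R : ∀ ⦃X Y Z : C⦄, 𝒯.Ext Z X → (X ⟶ Y) → (Y ⟶ Z) → Prop}
    (hR : ∀ ⦃X Y Z X' Z' : C⦄ (δ : 𝒯.Ext Z X) (x : X ⟶ Y) (y : Y ⟶ Z) (a : X ≅ X') (c : Z ≅ Z'),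
      R δ x y → R (𝒯.push a.hom (𝒯.pull c.inv δ)) (a.inv ≫ x) (y ≫ c.hom))
    (K X : ℤ → C) (g : ∀ n, K (n + 1) ⟶ X n) (f : ∀ n, X n ⟶ K n)
    (δ : ∀ n, 𝒯.Ext (K n) (K (n + 1))) (h : ∀ n, R (δ n) (g n) (f n)) :
    𝒯.Complete R (fun A => ∃ n, Nonempty (K n ≅ A)) := by
  rintro A ⟨n, ⟨e⟩⟩
  refine ⟨⟨_, _, _, _, _, ⟨n + 1, ⟨Iso.refl _⟩⟩, hR _ _ _ (Iso.refl _) e (h n)⟩, ?_⟩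
  -- Every integer is a successor, so each `K n` is also the left term of a triangle in the family.
  obtain ⟨n, rfl⟩ : ∃ m, n = m + 1 := ⟨n - 1, by simp⟩
  exact ⟨_, _, _, _, _, ⟨n, ⟨Iso.refl _⟩⟩, hR _ _ _ e (Iso.refl _) (h n)⟩

section Op

lemma cov_op_iff {W X Y Z : C} {x : X ⟶ Y} {y : Y ⟶ Z} :
    Cov (Opposite.op W) y.op x.op ↔ Contra W x y :=
  ⟨fun h => ⟨fun u hu => Quiver.Hom.op_inj (h.1 u.op (Quiver.Hom.unop_inj hu)), fun w => by
    obtain ⟨v, hv⟩ := h.2 w.op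
    exact ⟨v.unop, Quiver.Hom.op_inj hv⟩⟩,
  fun h => ⟨fun u hu => Quiver.Hom.unop_inj (h.1 u.unop (Quiver.Hom.op_inj hu)), fun w => by
    obtain ⟨v, hv⟩ := h.2 w.unop
    exact ⟨v.op, Quiver.Hom.unop_inj hv⟩⟩⟩

lemma contra_op_iff {W X Y Z : C} {x : X ⟶ Y} {y : Y ⟶ Z} :
    Contra (Opposite.op W) y.op x.op ↔ Cov W x y :=
  ⟨fun h => ⟨fun u hu => Quiver.Hom.op_inj (h.1 u.op (Quiver.Hom.unop_inj hu)), fun w => by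
    obtain ⟨v, hv⟩ := h.2 w.op
    exact ⟨v.unop, Quiver.Hom.op_inj hv⟩⟩,
  fun h => ⟨fun u hu => Quiver.Hom.unop_inj (h.1 u.unop (Quiver.Hom.op_inj hu)), fun w => by
    obtain ⟨v, hv⟩ := h.2 w.unop
    exact ⟨v.op, Quiver.Hom.unop_inj hv⟩⟩⟩

lemma proj_op_iff {P : C} : 𝒯.op.Proj (Opposite.op P) ↔ 𝒯.Inj P :=
  ⟨fun h _ _ _ δ x y t => cov_op_iff.1 (h (X := Opposite.op _) (Z := Opposite.op _) δ y.op x.op t),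
    fun h _ _ _ δ x y t => cov_op_iff.2 (h δ y.unop x.unop t)⟩

lemma inj_op_iff {P : C} : 𝒯.op.Inj (Opposite.op P) ↔ 𝒯.Proj P :=
  ⟨fun h _ _ _ δ x y t =>
    contra_op_iff.1 (h (X := Opposite.op _) (Z := Opposite.op _) δ y.op x.op t),
    fun h _ _ _ δ x y t => contra_op_iff.2 (h δ y.unop x.unop t)⟩

lemma projTri_op_iff {X Y Z : C} {δ : 𝒯.Ext Z X} {x : X ⟶ Y} {y : Y ⟶ Z} :
    𝒯.op.ProjTri (X := Opposite.op Z) (Z := Opposite.op X) δ y.op x.op ↔ 𝒯.InjTri δ x y :=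
  ⟨fun h => ⟨h.tri, proj_op_iff.1 h.proj, fun J hJ => contra_op_iff.1
    (h.contra (Opposite.op J) (proj_op_iff.2 hJ))⟩,
  fun h => ⟨h.tri, proj_op_iff.2 h.inj, fun J hJ => contra_op_iff.2
    (h.cov J.unop (proj_op_iff.1 hJ))⟩⟩

lemma injTri_op_iff {X Y Z : C} {δ : 𝒯.Ext Z X} {x : X ⟶ Y} {y : Y ⟶ Z} :
    𝒯.op.InjTri (X := Opposite.op Z) (Z := Opposite.op X) δ y.op x.op ↔ 𝒯.ProjTri δ x y :=
  ⟨fun h => ⟨h.tri, inj_op_iff.1 h.inj, fun J hJ => cov_op_iff.1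
    (h.cov (Opposite.op J) (inj_op_iff.2 hJ))⟩,
  fun h => ⟨h.tri, inj_op_iff.2 h.proj, fun J hJ => cov_op_iff.2
    (h.contra J.unop (inj_op_iff.1 hJ))⟩⟩

lemma GI.gp_op {A : C} (hA : 𝒯.GI A) : 𝒯.op.GP (Opposite.op A) := by
  obtain ⟨𝒢, h𝒢, hA⟩ := hA
  refine ⟨fun A => 𝒢 A.unop, fun A hA => ⟨?_, ?_⟩, hA⟩
  · obtain ⟨P, K, x, y, δ, hK, h⟩ := (h𝒢 _ hA).2
    exact ⟨_, _, y.op, x.op, δ, hK, projTri_op_iff.2 h⟩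
  · obtain ⟨K, P, x, y, δ, hK, h⟩ := (h𝒢 _ hA).1
    exact ⟨_, _, y.op, x.op, δ, hK, projTri_op_iff.2 h⟩

lemma GP.gi_op {A : C} (hA : 𝒯.GP A) : 𝒯.op.GI (Opposite.op A) := by
  obtain ⟨𝒢, h𝒢, hA⟩ := hA
  refine ⟨fun A => 𝒢 A.unop, fun A hA => ⟨?_, ?_⟩, hA⟩
  · obtain ⟨P, K, x, y, δ, hK, h⟩ := (h𝒢 _ hA).2
    exact ⟨_, _, y.op, x.op, δ, hK, injTri_op_iff.2 h⟩
  · obtain ⟨K, P, x, y, δ, hK, h⟩ := (h𝒢 _ hA).1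
    exact ⟨_, _, y.op, x.op, δ, hK, injTri_op_iff.2 h⟩

lemma GI.of_op {A : Cᵒᵖ} (hA : 𝒯.op.GP A) : 𝒯.GI A.unop := by
  obtain ⟨𝒢, h𝒢, hA⟩ := hA
  refine ⟨fun A => 𝒢 (Opposite.op A), fun A hA => ⟨?_, ?_⟩, hA⟩
  · obtain ⟨P, K, x, y, δ, hK, h⟩ := (h𝒢 _ hA).2
    exact ⟨_, _, y.unop, x.unop, δ, hK, projTri_op_iff.1 h⟩
  · obtain ⟨K, P, x, y, δ, hK, h⟩ := (h𝒢 _ hA).1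
    exact ⟨_, _, y.unop, x.unop, δ, hK, projTri_op_iff.1 h⟩

lemma FGI.op {A : C} (hA : 𝒯.FGI A) : 𝒯.op.FGP (Opposite.op A) := by
  induction hA with
  | of_gi G hG => exact .of_gp _ hG.gp_op
  | of_tri A G K δ x y h hG _ ih => exact .of_tri _ _ _ δ y.op x.op h hG.gp_op ih

lemma FGI.of_op {A : Cᵒᵖ} (hA : 𝒯.op.FGP A) : 𝒯.FGI A.unop := by
  induction hA with
  | of_gp G hG => exact .of_gi _ (GI.of_op hG)
  | of_tri K G A δ x y h hG _ ih => exact .of_tri _ _ _ δ y.unop x.unop h (GI.of_op hG) ih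

end Op

lemma FGP.exists_cov_approx (hP : ∃ P, 𝒯.Proj P) {M : C} (hM : 𝒯.FGP M) :
    ∃ (K G : C) (x : K ⟶ G) (y : G ⟶ M) (δ : 𝒯.Ext M K), 𝒯.FGP K ∧ 𝒯.GP G ∧ 𝒯.Tri δ x y ∧
      ∀ W, 𝒯.GP W → Cov W x y := by
  obtain ⟨K, G, x, y, δ, hK, hG, h⟩ := hM.exists_approx hP
  exact ⟨K, G, x, y, δ, hK.fgp, hG, h, fun W hW => hK.projTest.cov h hW⟩

lemma FGI.exists_contra_approx (hI : ∃ I, 𝒯.Inj I) {N : C} (hN : 𝒯.FGI N) :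
    ∃ (E K : C) (x : N ⟶ E) (y : E ⟶ K) (δ : 𝒯.Ext K N), 𝒯.FGI K ∧ 𝒯.GI E ∧ 𝒯.Tri δ x y ∧
      ∀ W, 𝒯.GI W → Contra W x y := by
  obtain ⟨I, hI⟩ := hI
  obtain ⟨K, G, x, y, δ, hK, hG, h, h'⟩ := hN.op.exists_cov_approx ⟨_, proj_op_iff.2 hI⟩
  exact ⟨G.unop, K.unop, y.unop, x.unop, δ, .of_op hK, .of_op hG, h,
    fun W hW => cov_op_iff.1 (h' _ hW.gp_op)⟩

lemma FGI.cov_coresolution (hI : ∃ I, 𝒯.Inj I) (K E : ℕ → C) (hN : 𝒯.FGI (K 0))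
    (δ : ∀ i, 𝒯.Ext (K (i + 1)) (K i)) (g : ∀ i, K i ⟶ E i) (f : ∀ i, E i ⟶ K (i + 1))
    (h : ∀ i, 𝒯.Tri (δ i) (g i) (f i)) (hE : ∀ i, 𝒯.GI (E i))
    (hf : ∀ i W, 𝒯.GI W → Contra W (g i) (f i)) (i : ℕ) (G : C) (hG : 𝒯.GP G) :
    Cov G (g i) (f i) := by
  obtain ⟨I, hI⟩ := hI
  exact contra_op_iff.1 (FGP.contra_resolution (𝒯 := 𝒯.op) ⟨_, proj_op_iff.2 hI⟩
    (fun i => Opposite.op (K i)) (fun i => Opposite.op (E i)) hN.op δ (fun i => (f i).op)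
    (fun i => (g i).op) h (fun i => (hE i).gp_op)
    (fun i W hW => cov_op_iff.2 (hf i W.unop (GI.of_op hW))) i (Opposite.op G) hG.gi_op)

end TriangleSystem

end Extri
-- The proper class as a triangle system.
namespace Extri

set_option linter.unusedSectionVars false

variable {C : Type u} [Category.{v} C] [Preadditive C] [HasZeroObject C] [HasBinaryBiproducts C]

/-- The triangle system of an extriangulated category. -/
noncomputable def Extriangulation.system (𝓔 : Extriangulation.{w} C) : TriangleSystem.{w} C where
  Ext Z X := Ext 𝓔.E Z X
  grp Z X := inferInstance
  push {_ _ Z} a := ((𝓔.E.obj (op Z)).map a).hom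
  pull {X _ _} c := ((𝓔.E.map c.op).app X).hom
  push_id δ := by simp
  push_comp a b δ := by simp
  pull_id δ := by simp
  pull_comp a b δ := by simp
  push_pull a c δ := (ConcreteCategory.congr_hom ((𝓔.E.map c.op).naturality a) δ).symm
  push_add {_ _ Z} a b δ := by
    have := 𝓔.additive_right (op Z)
    rw [Functor.map_add]
    rfl
  pull_add a b δ := by
    have := 𝓔.additive_left
    rw [op_add, Functor.map_add]
    rfl
  Tri := 𝓔.Realizes
  exists_tri := 𝓔.exists_realizes
  tri_iff := 𝓔.realizes_iff
  realize_hom := 𝓔.realize_hom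
  exists_sum A B := by
    refine ⟨A ⊞ B, biprod.inl, biprod.inr, biprod.fst, biprod.snd, by simp, by simp, by simp,
      by simp, biprod.total, 𝓔.realizes_zero A B, ?_⟩
    exact (𝓔.realizes_iff _ _ _ _ _ (𝓔.realizes_zero B A)).2
      ⟨biprod.braiding B A, by ext <;> simp [biprod.braiding], by simp [biprod.braiding]⟩
  et3 := 𝓔.et3
  et3_op := 𝓔.et3_op
  et4 := 𝓔.et4
  et4_op := 𝓔.et4_op

lemma Extriangulation.covExact_iff {𝓔 : Extriangulation.{w} C} {W X Y Z : C} {δ : Ext 𝓔.E Z X}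
    {x : X ⟶ Y} {y : Y ⟶ Z} (h : 𝓔.Realizes δ x y) :
    CovExact W x y ↔ TriangleSystem.Cov W x y := by
  have h' : 𝓔.system.Tri δ x y := h
  refine ⟨fun h => ⟨fun u hu => h.1 (by simpa using hu), h.2.2⟩, fun k => ⟨?_, fun u => ?_, k.2⟩⟩
  · intro u v huv
    exact sub_eq_zero.1 (k.1 _ (by simpa [sub_eq_zero] using huv))
  · refine ⟨fun hu => h'.exists_fac u hu, ?_⟩
    rintro ⟨a, rfl⟩
    simp [h'.comp_zero]

lemma Extriangulation.contraExact_iff {𝓔 : Extriangulation.{w} C} {W X Y Z : C}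
    {δ : Ext 𝓔.E Z X} {x : X ⟶ Y} {y : Y ⟶ Z} (h : 𝓔.Realizes δ x y) :
    ContraExact W x y ↔ TriangleSystem.Contra W x y := by
  have h' : 𝓔.system.Tri δ x y := h
  refine ⟨fun h => ⟨fun u hu => h.1 (by simpa using hu), h.2.2⟩, fun k => ⟨?_, fun u => ?_, k.2⟩⟩
  · intro u v huv
    exact sub_eq_zero.1 (k.1 _ (by simpa [sub_eq_zero] using huv))
  · refine ⟨fun hu => h'.exists_desc u hu, ?_⟩
    rintro ⟨a, rfl⟩
    simp [reassoc_of% h'.comp_zero]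

namespace ProperClass

variable {𝓔 : Extriangulation.{w} C} (ξ : ProperClass 𝓔)

/-- The extensions whose base changes to `ξ`-projective objects split. -/
noncomputable def ext (Z X : C) : AddSubgroup (𝓔.system.Ext Z X) where
  carrier := {δ | ∀ (P : C) (c : P ⟶ Z), ξ.Proj P → 𝓔.system.pull c δ = 0}
  zero_mem' P c _ := map_zero _
  add_mem' h h' P c hP := by rw [map_add, h P c hP, h' P c hP, add_zero]
  neg_mem' h P c hP := by rw [map_neg, h P c hP, neg_zero]

variable {ξ}

lemma comp_comp_eq_zero {X Y Z W W' : C} {δ : Ext 𝓔.E Z X} {x : X ⟶ Y} {y : Y ⟶ Z}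
    (h : ξ.mem x y δ) (u : W ⟶ X) (v : Z ⟶ W') : (u ≫ x) ≫ y ≫ v = 0 := by
  have := TriangleSystem.Tri.comp_zero (𝒯 := 𝓔.system) (ξ.realizes _ _ _ h)
  rw [Category.assoc, reassoc_of% this, zero_comp, comp_zero]

lemma ext_of_mem {X Y Z : C} {δ : Ext 𝓔.E Z X} {x : X ⟶ Y} {y : Y ⟶ Z} (h : ξ.mem x y δ) :
    δ ∈ ξ.ext Z X := fun _ c hP =>
  (TriangleSystem.Tri.pull_eq_zero_iff (𝒯 := 𝓔.system) (ξ.realizes x y δ h) c).2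
    ((hP x y δ h).2.2 c)

/-- Base change along a `ξ`-projective presentation of `Z` splits, and split triangles are in `ξ`;
saturation then gives membership. -/
lemma mem_iff (hproj : ξ.EnoughProj) {X Y Z : C} {δ : Ext 𝓔.E Z X} {x : X ⟶ Y} {y : Y ⟶ Z} :
    ξ.mem x y δ ↔ 𝓔.Realizes δ x y ∧ δ ∈ ξ.ext Z X := by
  refine ⟨fun h => ⟨ξ.realizes x y δ h, ext_of_mem h⟩, fun ⟨h, h'⟩ => ?_⟩
  obtain ⟨K, P, k, p, ε, hε, hP⟩ := hproj Z
  obtain ⟨W, m, e, hW⟩ := 𝓔.exists_realizes (0 : Ext 𝓔.E P X)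
  have h₀ : pull 𝓔.E p δ = 0 := h' P p hP
  exact ξ.saturated x y δ k p ε m e h hε (h₀ ▸ ξ.of_split m e hW)

/-- If the pushout of `δ` to an injective `I` containing `X` vanishes, `δ` is a base change of `X ⟶
I ⟶ L`. This self-dual description is what closes the subbifunctor under both (ET4) and its dual. -/
lemma ext_iff (hproj : ξ.EnoughProj) (hinj : ξ.EnoughInj) {X Z : C} {δ : Ext 𝓔.E Z X} :
    δ ∈ ξ.ext Z X ↔ ∀ (I : C) (a : X ⟶ I), ξ.Inj I → 𝓔.system.push a δ = 0 := by
  obtain ⟨Y, x, y, h⟩ := 𝓔.exists_realizes δ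
  refine ⟨fun hδ I a hI => ?_, fun hδ => ?_⟩
  · exact (TriangleSystem.Tri.push_eq_zero_iff (𝒯 := 𝓔.system) h a).2
      ((hI x y δ ((mem_iff hproj).2 ⟨h, hδ⟩)).2.2 a)
  · obtain ⟨I, L, i, p, ε, hε, hI⟩ := hinj X
    obtain ⟨c, rfl⟩ := TriangleSystem.Tri.exists_eq_pull (𝒯 := 𝓔.system) (ξ.realizes i p ε hε) δ
      (hδ I i hI)
    exact ext_of_mem (ξ.base_change i p ε c x y hε h)

/-- The triangle system of the `𝔼`-triangles in `ξ`. -/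
noncomputable def system (hproj : ξ.EnoughProj) (hinj : ξ.EnoughInj) : TriangleSystem.{w} C where
  Ext Z X := ξ.ext Z X
  grp Z X := inferInstance
  push a := ((𝓔.system.push a).comp (ξ.ext _ _).subtype).codRestrict _ fun δ P c hP => by
    simp [← 𝓔.system.push_pull, δ.2 P c hP]
  pull d := ((𝓔.system.pull d).comp (ξ.ext _ _).subtype).codRestrict _ fun δ P c hP => by
    simp [← 𝓔.system.pull_comp, δ.2 P (c ≫ d) hP]
  push_id δ := Subtype.ext (𝓔.system.push_id _)
  push_comp a b δ := Subtype.ext (𝓔.system.push_comp a b _)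
  pull_id δ := Subtype.ext (𝓔.system.pull_id _)
  pull_comp a b δ := Subtype.ext (𝓔.system.pull_comp a b _)
  push_pull a c δ := Subtype.ext (𝓔.system.push_pull a c _)
  push_add a b δ := Subtype.ext (𝓔.system.push_add a b _)
  pull_add a b δ := Subtype.ext (𝓔.system.pull_add a b _)
  Tri X Y Z δ x y := 𝓔.Realizes δ.1 x y
  exists_tri X Z δ := 𝓔.exists_realizes δ.1
  tri_iff X Y Y' Z δ := 𝓔.realizes_iff δ.1
  realize_hom X Y Z X' Y' Z' δ δ' x y x' y' a c h h' e :=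
    𝓔.realize_hom δ.1 δ'.1 x y x' y' a c h h' (congrArg Subtype.val e)
  exists_sum A B := 𝓔.system.exists_sum A B
  et3 X Y Z X' Y' Z' δ δ' x y x' y' a b h h' e := by
    obtain ⟨c, h₁, h₂⟩ := 𝓔.et3 δ.1 δ'.1 x y x' y' a b h h' e
    exact ⟨c, h₁, Subtype.ext h₂⟩
  et3_op X Y Z X' Y' Z' δ δ' x y x' y' b c h h' e := by
    obtain ⟨a, h₁, h₂⟩ := 𝓔.et3_op δ.1 δ'.1 x y x' y' b c h h' e
    exact ⟨a, h₁, Subtype.ext h₂⟩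
  et4 A B D G F δ δ' f f' g g' h h' := by
    obtain ⟨H, k, d, e, δ'', h₁, h₂, h₃, h₄, h₅, h₆⟩ := 𝓔.et4 δ.1 δ'.1 f f' g g' h h'
    refine ⟨H, k, d, e, ⟨δ'', (ext_iff hproj hinj).2 fun I a hI => ?_⟩, h₁, h₂, h₃, h₄,
      Subtype.ext h₅, Subtype.ext h₆⟩
    -- A map from `A` to an injective extends along `f` and then along `g`, so it kills `δ''`.
    obtain ⟨u, rfl⟩ := (TriangleSystem.Tri.push_eq_zero_iff (𝒯 := 𝓔.system) h a).1
      ((ext_iff hproj hinj).1 δ.2 I a hI)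
    obtain ⟨u, rfl⟩ := (TriangleSystem.Tri.push_eq_zero_iff (𝒯 := 𝓔.system) h' u).1
      ((ext_iff hproj hinj).1 δ'.2 I u hI)
    exact (TriangleSystem.Tri.push_eq_zero_iff (𝒯 := 𝓔.system) h₁ _).2 ⟨u, by simp⟩
  et4_op A B D G F δ δ' f' f g' g h h' := by
    obtain ⟨H, d, e, k, δ'', h₁, h₂, h₃, h₄, h₅, h₆⟩ := 𝓔.et4_op δ.1 δ'.1 f' f g' g h h'
    refine ⟨H, d, e, k, ⟨δ'', fun P c hP => ?_⟩, h₁, h₂, h₃, h₄,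
      Subtype.ext h₅, Subtype.ext h₆⟩
    obtain ⟨u, rfl⟩ := (TriangleSystem.Tri.pull_eq_zero_iff (𝒯 := 𝓔.system) h' c).1 (δ'.2 P c hP)
    obtain ⟨u, rfl⟩ := (TriangleSystem.Tri.pull_eq_zero_iff (𝒯 := 𝓔.system) h u).1 (δ.2 P u hP)
    exact (TriangleSystem.Tri.pull_eq_zero_iff (𝒯 := 𝓔.system) h₁ _).2 ⟨u, by simp⟩

/-! ### Dictionary between `ξ` and its triangle system; existence and exactness of resolutions. -/

section Comparison

variable (hproj : ξ.EnoughProj) (hinj : ξ.EnoughInj)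

lemma system_tri_iff {X Y Z : C} (δ : ξ.ext Z X) {x : X ⟶ Y} {y : Y ⟶ Z} :
    (system hproj hinj).Tri δ x y ↔ ξ.mem x y δ.1 :=
  ⟨fun h => (mem_iff hproj).2 ⟨h, δ.2⟩, fun h => ξ.realizes _ _ _ h⟩

lemma system_proj_iff {P : C} : (system hproj hinj).Proj P ↔ ξ.Proj P :=
  ⟨fun h _ _ _ x y δ hδ => (Extriangulation.covExact_iff (ξ.realizes x y δ hδ)).2
    (h ⟨δ, ext_of_mem hδ⟩ x y (ξ.realizes x y δ hδ)),
  fun h _ _ _ δ x y hδ => (Extriangulation.covExact_iff hδ).1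
    (h x y δ.1 ((system_tri_iff hproj hinj δ).1 hδ))⟩

lemma system_inj_iff {I : C} : (system hproj hinj).Inj I ↔ ξ.Inj I :=
  ⟨fun h _ _ _ x y δ hδ => (Extriangulation.contraExact_iff (ξ.realizes x y δ hδ)).2
    (h ⟨δ, ext_of_mem hδ⟩ x y (ξ.realizes x y δ hδ)),
  fun h _ _ _ δ x y hδ => (Extriangulation.contraExact_iff hδ).1
    (h x y δ.1 ((system_tri_iff hproj hinj δ).1 hδ))⟩

lemma exists_exactData (K X : ℤ → C) (g : ∀ n, K (n + 1) ⟶ X n) (f : ∀ n, X n ⟶ K n)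
    (δ : ∀ n, Ext 𝓔.E (K n) (K (n + 1))) (h : ∀ n, ξ.mem (g n) (f n) (δ n)) :
    ∃ (P : ChainComplex C ℤ) (D : ξ.ExactData P) (_ : P.X = X),
      D.K = K ∧ HEq D.g g ∧ HEq D.f f := by
  let P : ChainComplex C ℤ := ChainComplex.of X (fun n => f (n + 1) ≫ g n) fun n =>
      comp_comp_eq_zero (h (n + 1)) _ _
  exact ⟨P, ⟨K, g, f, δ, h, fun n => ChainComplex.of_d X (fun n => f (n + 1) ≫ g n) n⟩, rfl, rfl,
    HEq.rfl, HEq.rfl⟩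

lemma system_gp_iff {A : C} : (system hproj hinj).GP A ↔ ξ.GProj A := by
  constructor
  · rintro ⟨𝒢, h𝒢, hA⟩
    obtain ⟨K, X, g, f, δ, h, rfl⟩ := h𝒢.exists_family hA
    obtain ⟨P, ⟨K, g, f, δ', h', hd⟩, rfl, rfl, hg, hf⟩ := exists_exactData K X g f
      (fun n => (δ n).1) fun n => (system_tri_iff hproj hinj _).1 (h n).tri
    obtain rfl := eq_of_heq hg
    obtain rfl := eq_of_heq hf
    exact ⟨P, ⟨K, g, f, δ', h', hd⟩, fun n => (system_proj_iff hproj hinj).1 (h n).proj,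
      fun n Q hQ => (Extriangulation.contraExact_iff (h n).tri).2
        ((h n).contra Q ((system_proj_iff hproj hinj).2 hQ)), 0, ⟨Iso.refl _⟩⟩
  · rintro ⟨P, D, hP, hQ, n, hn⟩
    exact ⟨_, TriangleSystem.complete_of_family (fun _ _ _ _ _ δ x y a c h => h.of_iso a c)
      D.K P.X D.g D.f (fun n => ⟨D.δ n, ext_of_mem (D.mem n)⟩) fun n =>
        ⟨ξ.realizes _ _ _ (D.mem n), (system_proj_iff hproj hinj).2 (hP n), fun Q hQ' =>
          (Extriangulation.contraExact_iff (ξ.realizes _ _ _ (D.mem n))).1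
            (hQ n Q ((system_proj_iff hproj hinj).1 hQ'))⟩, n, hn⟩

lemma system_gi_iff {A : C} : (system hproj hinj).GI A ↔ ξ.GInj A := by
  constructor
  · rintro ⟨𝒢, h𝒢, hA⟩
    obtain ⟨K, X, g, f, δ, h, rfl⟩ := h𝒢.exists_family hA
    obtain ⟨P, ⟨K, g, f, δ', h', hd⟩, rfl, rfl, hg, hf⟩ := exists_exactData K X g f
      (fun n => (δ n).1) fun n => (system_tri_iff hproj hinj _).1 (h n).tri
    obtain rfl := eq_of_heq hg
    obtain rfl := eq_of_heq hf
    exact ⟨P, ⟨K, g, f, δ', h', hd⟩, fun n => (system_inj_iff hproj hinj).1 (h n).inj,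
      fun n Q hQ => (Extriangulation.covExact_iff (h n).tri).2
        ((h n).cov Q ((system_inj_iff hproj hinj).2 hQ)), 0, ⟨Iso.refl _⟩⟩
  · rintro ⟨P, D, hP, hQ, n, hn⟩
    exact ⟨_, TriangleSystem.complete_of_family (fun _ _ _ _ _ δ x y a c h => h.of_iso a c)
      D.K P.X D.g D.f (fun n => ⟨D.δ n, ext_of_mem (D.mem n)⟩) fun n =>
        ⟨ξ.realizes _ _ _ (D.mem n), (system_inj_iff hproj hinj).2 (hP n), fun Q hQ' =>
          (Extriangulation.covExact_iff (ξ.realizes _ _ _ (D.mem n))).1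
            (hQ n Q ((system_inj_iff hproj hinj).1 hQ'))⟩, n, hn⟩

lemma FiniteGPd.fgp {M : C} (hM : ξ.FiniteGPd M) : (system hproj hinj).FGP M := by
  obtain ⟨n, hn⟩ := hM
  induction hn with
  | of_gproj n A hA => exact .of_gp A ((system_gp_iff hproj hinj).2 hA)
  | of_triangle n K G A x y δ h hG _ ih =>
    exact .of_tri K G A ⟨δ, ext_of_mem h⟩ x y (ξ.realizes x y δ h)
      ((system_gp_iff hproj hinj).2 hG) ih

lemma FiniteGId.fgi {N : C} (hN : ξ.FiniteGId N) : (system hproj hinj).FGI N := by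
  obtain ⟨n, hn⟩ := hN
  induction hn with
  | of_ginj n A hA => exact .of_gi A ((system_gi_iff hproj hinj).2 hA)
  | of_triangle n A G K x y δ h hG _ ih =>
    exact .of_tri A G K ⟨δ, ext_of_mem h⟩ x y (ξ.realizes x y δ h)
      ((system_gi_iff hproj hinj).2 hG) ih

lemma exists_system_proj : ∃ P, (system hproj hinj).Proj P := by
  obtain ⟨⟨Z, -⟩⟩ := ‹HasZeroObject C›
  obtain ⟨K, P, x, y, δ, -, hP⟩ := hproj Z
  exact ⟨P, (system_proj_iff hproj hinj).2 hP⟩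

lemma exists_system_inj : ∃ I, (system hproj hinj).Inj I := by
  obtain ⟨⟨Z, -⟩⟩ := ‹HasZeroObject C›
  obtain ⟨I, K, x, y, δ, -, hI⟩ := hinj Z
  exact ⟨I, (system_inj_iff hproj hinj).2 hI⟩

lemma FiniteGPd.nonempty_resolution {M : C} (hM : ξ.FiniteGPd M) (hproj : ξ.EnoughProj)
    (hinj : ξ.EnoughInj) : Nonempty (ξ.GProjResolution M) := by
  have step : ∀ M : {M // (system hproj hinj).FGP M}, ∃ K : {M // (system hproj hinj).FGP M},
      ∃ (G : C) (x : K.1 ⟶ G) (y : G ⟶ M.1) (δ : Ext 𝓔.E M.1 K.1), ξ.mem x y δ ∧ ξ.GProj G ∧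
        ∀ W, ξ.GProj W → CovExact W x y := fun M => by
    obtain ⟨K, G, x, y, δ, hK, hG, h, h'⟩ :=
      M.2.exists_cov_approx (exists_system_proj hproj hinj)
    exact ⟨⟨K, hK⟩, G, x, y, δ.1, (system_tri_iff hproj hinj δ).1 h,
      (system_gp_iff hproj hinj).1 hG, fun W hW => (Extriangulation.covExact_iff h).2
        (h' W ((system_gp_iff hproj hinj).2 hW))⟩
  choose L G x y δ h hG hW using step
  let K : ℕ → {M // (system hproj hinj).FGP M} :=
    fun n => Nat.rec ⟨M, hM.fgp hproj hinj⟩ (fun _ => L) n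
  exact ⟨{
    G := ChainComplex.of (fun n => G (K n)) (fun n => y (K (n + 1)) ≫ x (K n)) fun n =>
      comp_comp_eq_zero (h (K (n + 1))) _ _
    K := fun n => (K n).1
    K_zero := rfl
    g := fun n => x (K n)
    f := fun n => y (K n)
    δ := fun n => δ (K n)
    mem := fun n => h (K n)
    d_eq := fun n => ChainComplex.of_d (fun n => G (K n)) (fun n => y (K (n + 1)) ≫ x (K n)) n
    gproj := fun n => hG (K n)
    exact := fun n => hW (K n) }⟩

lemma FiniteGId.nonempty_coresolution {N : C} (hN : ξ.FiniteGId N) (hproj : ξ.EnoughProj)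
    (hinj : ξ.EnoughInj) : Nonempty (ξ.GInjCoresolution N) := by
  have step : ∀ N : {N // (system hproj hinj).FGI N}, ∃ K : {N // (system hproj hinj).FGI N},
      ∃ (E : C) (x : N.1 ⟶ E) (y : E ⟶ K.1) (δ : Ext 𝓔.E K.1 N.1), ξ.mem x y δ ∧ ξ.GInj E ∧
        ∀ W, ξ.GInj W → ContraExact W x y := fun N => by
    obtain ⟨E, K, x, y, δ, hK, hE, h, h'⟩ :=
      N.2.exists_contra_approx (exists_system_inj hproj hinj)
    exact ⟨⟨K, hK⟩, E, x, y, δ.1, (system_tri_iff hproj hinj δ).1 h,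
      (system_gi_iff hproj hinj).1 hE, fun W hW => (Extriangulation.contraExact_iff h).2
        (h' W ((system_gi_iff hproj hinj).2 hW))⟩
  choose L E x y δ h hE hW using step
  let K : ℕ → {N // (system hproj hinj).FGI N} :=
    fun n => Nat.rec ⟨N, hN.fgi hproj hinj⟩ (fun _ => L) n
  exact ⟨{
    E := CochainComplex.of (fun n => E (K n)) (fun n => y (K n) ≫ x (K (n + 1))) fun n =>
      comp_comp_eq_zero (h (K (n + 1))) _ _
    K := fun n => (K n).1
    K_zero := rfl
    g := fun n => x (K n)
    f := fun n => y (K n)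
    δ := fun n => δ (K n)
    mem := fun n => h (K n)
    d_eq := fun n => CochainComplex.of_d (fun n => E (K n)) (fun n => y (K n) ≫ x (K (n + 1))) n
    ginj := fun n => hE (K n)
    exact := fun n => hW (K n) }⟩

lemma GProjResolution.contraExact {M : C} (R : ξ.GProjResolution M) (hM : ξ.FiniteGPd M)
    (hproj : ξ.EnoughProj) (hinj : ξ.EnoughInj) (i : ℕ) (E : C) (hE : ξ.GInj E) :
    ContraExact E (R.g i) (R.f i) := by
  refine (Extriangulation.contraExact_iff (ξ.realizes _ _ _ (R.mem i))).2 ?_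
  refine TriangleSystem.FGP.contra_resolution (𝒯 := system hproj hinj)
    (exists_system_proj hproj hinj) R.K R.G.X (by rw [R.K_zero]; exact hM.fgp hproj hinj)
    (fun i => ⟨R.δ i, ext_of_mem (R.mem i)⟩) R.g R.f (fun i => ξ.realizes _ _ _ (R.mem i))
    (fun i => (system_gp_iff hproj hinj).2 (R.gproj i)) (fun i W hW => ?_) i E
    ((system_gi_iff hproj hinj).2 hE)
  exact (Extriangulation.covExact_iff (ξ.realizes _ _ _ (R.mem i))).1
    (R.exact i W ((system_gp_iff hproj hinj).1 hW))

lemma GInjCoresolution.covExact {N : C} (S : ξ.GInjCoresolution N) (hN : ξ.FiniteGId N)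
    (hproj : ξ.EnoughProj) (hinj : ξ.EnoughInj) (i : ℕ) (G : C) (hG : ξ.GProj G) :
    CovExact G (S.g i) (S.f i) := by
  refine (Extriangulation.covExact_iff (ξ.realizes _ _ _ (S.mem i))).2 ?_
  refine TriangleSystem.FGI.cov_coresolution (𝒯 := system hproj hinj)
    (exists_system_inj hproj hinj) S.K S.E.X (by rw [S.K_zero]; exact hN.fgi hproj hinj)
    (fun i => ⟨S.δ i, ext_of_mem (S.mem i)⟩) S.g S.f (fun i => ξ.realizes _ _ _ (S.mem i))
    (fun i => (system_gi_iff hproj hinj).2 (S.ginj i)) (fun i W hW => ?_) i G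
    ((system_gp_iff hproj hinj).2 hG)
  exact (Extriangulation.contraExact_iff (ξ.realizes _ _ _ (S.mem i))).1
    (S.exact i W ((system_gi_iff hproj hinj).1 hW))

end Comparison

end ProperClass

end Extri
-- Dimension shifting in an abelian category.
namespace Extri

section Balance

open HomologicalComplex

variable {𝒜 : Type u} [Category.{v} 𝒜] [Abelian 𝒜]

/-- `Y` is the kernel of `q`, so the homology is the cokernel of `p`, which is `H`. -/
lemma nonempty_homology_iso_of_exact {X Y Z W H : 𝒜} (p : X ⟶ Y) (i : Y ⟶ Z) (q : Z ⟶ W)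
    (π : Y ⟶ H) [Mono i] [Epi π] (wi : i ≫ q = 0) (hi : (ShortComplex.mk i q wi).Exact)
    (wπ : p ≫ π = 0) (hπ : (ShortComplex.mk p π wπ).Exact) (w : (p ≫ i) ≫ q = 0) :
    Nonempty ((ShortComplex.mk (p ≫ i) q w).homology ≅ H) := by
  have hk : IsLimit (KernelFork.ofι (f := q) i wi) := hi.fIsKernel
  have hc : IsColimit (CokernelCofork.ofπ (f := p) π wπ) := hπ.gIsCokernel
  have hl : hk.lift (KernelFork.ofι (p ≫ i) w) = p := by
    rw [← cancel_mono i]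
    exact hk.fac _ WalkingParallelPair.zero
  have hc' : ∀ (p' : X ⟶ Y) (_ : p' = p) (w' : p' ≫ π = 0),
      Nonempty (IsColimit (CokernelCofork.ofπ (f := p') π w')) := by
    rintro _ rfl _
    exact ⟨hc⟩
  let h : (ShortComplex.mk (p ≫ i) q w).LeftHomologyData :=
    { K := Y
      H := H
      i := i
      π := π
      wi := wi
      hi := hk
      wπ := by rw [hl]; exact wπ
      hπ := (hc' _ hl _).some }
  exact ⟨h.homologyIso⟩

variable (L A : ℕ → CochainComplex 𝒜 ℕ)
  (a : ∀ i, L i ⟶ A i) (b : ∀ i, A i ⟶ L (i + 1)) (w : ∀ i, a i ≫ b i = 0)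
  (hS : ∀ i, (ShortComplex.mk (a i) (b i) (w i)).ShortExact)
  (hA : ∀ i m, IsZero ((A i).homology (m + 1)))

include hS hA

lemma nonempty_dimension_shift (k m n : ℕ) (hn : n = m + k + 1) :
    Nonempty ((L 0).homology n ≅ (L k).homology (m + 1)) := by
  induction k generalizing m with
  | zero => subst hn; exact ⟨Iso.refl _⟩
  | succ k ih =>
    obtain ⟨e⟩ := ih (m + 1) (by omega)
    exact ⟨e ≪≫ ((hS k).δIso (m + 1) (m + 1 + 1) rfl (hA k m) (hA k (m + 1))).symm⟩

/-- `H⁰` of `L (n + 1)` is the kernel of the second map. The image of `H⁰` of `A n` in it has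
cokernel `H¹` of `L n`, by acyclicity of `A n`, and shifting turns this into degree `n + 1` of `L
0`. -/
lemma nonempty_homology_iso_of_shortExact (n : ℕ)
    (hw : (homologyMap (b n) 0 ≫ homologyMap (a (n + 1)) 0) ≫
      homologyMap (b (n + 1)) 0 ≫ homologyMap (a (n + 2)) 0 = 0) :
    Nonempty ((ShortComplex.mk (homologyMap (b n) 0 ≫ homologyMap (a (n + 1)) 0)
      (homologyMap (b (n + 1)) 0 ≫ homologyMap (a (n + 2)) 0) hw).homology ≅
        (L 0).homology (n + 1)) := by
  have hm : ∀ i, Mono (homologyMap (a i) 0) := fun i => by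
    have : Mono (a i) := (hS i).mono_f
    exact mono_homologyMap_of_mono_of_not_rel _ 0 (by simp)
  have hd : Epi ((hS n).δ 0 1 rfl) := (hS n).epi_δ 0 1 rfl (hA n 0)
  have hw' : homologyMap (a (n + 1)) 0 ≫ homologyMap (b (n + 1)) 0 = 0 := by
    rw [← homologyMap_comp, w, homologyMap_zero]
  have h₁ : (ShortComplex.mk (homologyMap (a (n + 1)) 0) (homologyMap (b (n + 1)) 0) hw').Exact :=
    (hS (n + 1)).homology_exact₂ 0
  -- Composing with the monomorphism induced by `a (n + 2)` leaves the kernel unchanged.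
  have h₁' : (ShortComplex.mk (homologyMap (a (n + 1)) 0)
      (homologyMap (b (n + 1)) 0 ≫ homologyMap (a (n + 2)) 0)
      (by rw [reassoc_of% hw', zero_comp])).Exact :=
    (ShortComplex.exact_iff_of_epi_of_isIso_of_mono
      (S₁ := ShortComplex.mk (homologyMap (a (n + 1)) 0) (homologyMap (b (n + 1)) 0) hw')
      (S₂ := ShortComplex.mk (homologyMap (a (n + 1)) 0)
        (homologyMap (b (n + 1)) 0 ≫ homologyMap (a (n + 2)) 0) _)
      { τ₁ := 𝟙 _, τ₂ := 𝟙 _, τ₃ := homologyMap (a (n + 2)) 0 }).1 h₁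
  obtain ⟨e⟩ := nonempty_dimension_shift L A a b w hS hA n 0 (n + 1) (by omega)
  obtain ⟨e'⟩ := nonempty_homology_iso_of_exact (homologyMap (b n) 0) (homologyMap (a (n + 1)) 0)
    (homologyMap (b (n + 1)) 0 ≫ homologyMap (a (n + 2)) 0) ((hS n).δ 0 1 rfl)
    (by rw [reassoc_of% hw', zero_comp])
    h₁' ((hS n).comp_δ 0 1 rfl) ((hS n).homology_exact₃ 0 1 rfl) hw
  exact ⟨e' ≪≫ e.symm⟩

lemma nonempty_homology_iso (D : CochainComplex 𝒜 ℕ) (ψ : ∀ i, D.X i ⟶ (A i).X 0)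
    (hψ : ∀ i, Mono (ψ i)) (hψ' : ∀ i, ψ i ≫ (A i).d 0 1 = 0)
    (hD : ∀ i, (ShortComplex.mk (ψ i) ((A i).d 0 1) (hψ' i)).Exact)
    (comm : ∀ i, D.d i (i + 1) ≫ ψ (i + 1) = ψ i ≫ (b i).f 0 ≫ (a (i + 1)).f 0) (n : ℕ) :
    Nonempty (D.homology (n + 1) ≅ (L 0).homology (n + 1)) := by
  -- Since `ψ i` is a kernel of the first differential of `A i`, it identifies `D.X i` with `H⁰` of
  -- `A i`; `comm` makes this an isomorphism of complexes.
  let c (i : ℕ) : D.X i ⟶ (A i).homology 0 :=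
    (A i).liftCycles (ψ i) 1 (by simp) (hψ' i) ≫ (A i).homologyπ 0
  have hc : ∀ i, IsIso (c i) := fun i => by
    have : IsIso ((A i).liftCycles (ψ i) 1 (by simp) (hψ' i)) := by
      let e := IsLimit.conePointUniqueUpToIso (hD i).fIsKernel ((A i).cyclesIsKernel 0 1 (by simp))
      have he : e.hom = (A i).liftCycles (ψ i) 1 (by simp) (hψ' i) := by
        rw [← cancel_mono ((A i).iCycles 0), liftCycles_i]
        exact IsLimit.conePointUniqueUpToIso_hom_comp _ _ WalkingParallelPair.zero
      rw [← he]
      infer_instance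
    infer_instance
  have hcomm : ∀ i, c i ≫ homologyMap (b i) 0 ≫ homologyMap (a (i + 1)) 0 =
      D.d i (i + 1) ≫ c (i + 1) := fun i => by
    simp only [c, Category.assoc, homologyπ_naturality_assoc, homologyπ_naturality]
    rw [← cyclesMap_comp_assoc, ← Category.assoc, ← Category.assoc]
    congr 1
    rw [← cancel_mono ((A (i + 1)).iCycles 0)]
    simp [comm]
  have hw : ∀ i, (homologyMap (b i) 0 ≫ homologyMap (a (i + 1)) 0) ≫
      homologyMap (b (i + 1)) 0 ≫ homologyMap (a (i + 2)) 0 = 0 := fun i => by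
    rw [← cancel_epi (c i), ← Category.assoc, hcomm i, Category.assoc, hcomm (i + 1)]
    simp
  obtain ⟨e⟩ := nonempty_homology_iso_of_shortExact L A a b w hS hA n (hw n)
  refine ⟨ShortComplex.homologyMapIso (D.isoSc' n (n + 1) (n + 2) (by simp) (by simp) ≪≫
    ShortComplex.isoMk (S₁ := D.sc' n (n + 1) (n + 2)) (S₂ := ShortComplex.mk _ _ (hw n))
      (@asIso _ _ _ _ (c n) (hc n)) (@asIso _ _ _ _ (c (n + 1)) (hc (n + 1)))
      (@asIso _ _ _ _ (c (n + 2)) (hc (n + 2))) (hcomm n) (hcomm (n + 1))) ≪≫ e⟩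

end Balance

end Extri
-- The bicomplex of morphisms from the resolution to the coresolution.
namespace Extri

section HomComplex

variable {C : Type u} [Category.{v} C] [Preadditive C]

/-- The complex `C(X, E)`. -/
noncomputable abbrev homComplex (E : CochainComplex C ℕ) (X : C) :
    CochainComplex AddCommGrpCat.{v} ℕ :=
  ((preadditiveCoyoneda.obj (op X)).mapHomologicalComplex _).obj E

/-- Functoriality of the complex `C(X, E)` in `X`. -/
noncomputable abbrev homComplexMap (E : CochainComplex C ℕ) {X Y : C} (f : X ⟶ Y) :
    homComplex E Y ⟶ homComplex E X :=
  (NatTrans.mapHomologicalComplex (preadditiveCoyoneda.map f.op) (ComplexShape.up ℕ)).app E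

lemma homComplexMap_comp_eq_zero {E : CochainComplex C ℕ} {X Y Z : C} {g : X ⟶ Y} {f : Y ⟶ Z}
    (h : ∀ j, ContraExact (E.X j) g f) : homComplexMap E f ≫ homComplexMap E g = 0 := by
  ext j u
  exact (h j).2.1.apply_apply_eq_zero u

lemma homComplex_shortExact {E : CochainComplex C ℕ} {X Y Z : C} {g : X ⟶ Y} {f : Y ⟶ Z}
    (h : ∀ j, ContraExact (E.X j) g f) :
    (ShortComplex.mk (homComplexMap E f) (homComplexMap E g)
      (homComplexMap_comp_eq_zero h)).ShortExact := by
  refine HomologicalComplex.shortExact_of_degreewise_shortExact _ fun j => ?_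
  exact
    { exact := (ShortComplex.ab_exact_iff_function_exact _).2 (h j).2.1
      mono_f := (AddCommGrpCat.mono_iff_injective _).2 (h j).1
      epi_g := (AddCommGrpCat.epi_iff_surjective _).2 (h j).2.2 }

variable {E : CochainComplex C ℕ} {L : ℕ → C} {g : ∀ j, L j ⟶ E.X j} {f : ∀ j, E.X j ⟶ L (j + 1)}
  (hd : ∀ j, E.d j (j + 1) = f j ≫ g (j + 1)) {X : C} (h : ∀ j, CovExact X (g j) (f j))

include hd h

lemma isZero_homology_homComplex (m : ℕ) : IsZero ((homComplex E X).homology (m + 1)) := by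
  refine HomologicalComplex.ExactAt.isZero_homology ?_
  rw [HomologicalComplex.exactAt_iff' _ m (m + 1) (m + 2) (by simp) (by simp),
    ShortComplex.ab_exact_iff]
  intro (u : X ⟶ E.X (m + 1)) (hu : u ≫ E.d (m + 1) (m + 2) = 0)
  obtain ⟨t, ht⟩ := ((h (m + 1)).2.1 u).1 ((h (m + 2)).1 (by
    simpa [hd] using hu))
  obtain ⟨s, rfl⟩ := (h m).2.2 t
  refine ⟨s, ?_⟩
  change s ≫ E.d m (m + 1) = u
  rw [hd, ← ht]
  simp

lemma homComplex_exact_zero (u : X ⟶ E.X 0) (hu : u ≫ E.d 0 1 = 0) : ∃ t : X ⟶ L 0, t ≫ g 0 = u :=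
  ((h 0).2.1 u).1 ((h 1).1 (by simpa [hd] using hu))

end HomComplex

section Bicomplex

variable {C : Type u} [Category.{v} C] [Preadditive C]
  {G : ChainComplex C ℕ} {K : ℕ → C} {g : ∀ i, K (i + 1) ⟶ G.X i} {f : ∀ i, G.X i ⟶ K i}
  {E : CochainComplex C ℕ} {L : ℕ → C} {g' : ∀ j, L j ⟶ E.X j} {f' : ∀ j, E.X j ⟶ L (j + 1)}

/-- Dimension shifting applies to `L i = C(K i, E)` and `A i = C(G i, E)`: the latter is acyclic in
positive degrees with `H⁰ = C(G i, N)`, where `N` is `L 0` of the coresolution. -/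
lemma nonempty_balance_iso (hd : ∀ i, G.d (i + 1) i = f (i + 1) ≫ g i)
    (hd' : ∀ j, E.d j (j + 1) = f' j ≫ g' (j + 1))
    (h : ∀ i j, ContraExact (E.X j) (g i) (f i)) (h' : ∀ i j, CovExact (G.X i) (g' j) (f' j))
    (n : ℕ) :
    Nonempty ((((preadditiveYoneda.obj (L 0)).mapHomologicalComplex _).obj G.op).homology (n + 1) ≅
      (homComplex E (K 0)).homology (n + 1)) := by
  refine nonempty_homology_iso (fun i => homComplex E (K i)) (fun i => homComplex E (G.X i))
    (fun i => homComplexMap E (f i)) (fun i => homComplexMap E (g i))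
    (fun i => homComplexMap_comp_eq_zero (h i)) (fun i => homComplex_shortExact (h i))
    (fun i m => isZero_homology_homComplex hd' (h' i) m)
    (((preadditiveYoneda.obj (L 0)).mapHomologicalComplex _).obj G.op)
    (fun i => (preadditiveCoyoneda.obj (op (G.X i))).map (g' 0)) (fun i => ?_) (fun i => ?_)
    (fun i => ?_) (fun i => ?_) n
  · exact (AddCommGrpCat.mono_iff_injective _).2 (h' i 0).1
  · ext (u : G.X i ⟶ L 0)
    change (u ≫ g' 0) ≫ E.d 0 1 = 0
    have := (h' i 0).2.1.apply_apply_eq_zero u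
    rw [hd', ← Category.assoc]
    simp at this
    simp [reassoc_of% this]
  · rw [ShortComplex.ab_exact_iff]
    exact fun u hu => homComplex_exact_zero hd' (h' i) u hu
  · ext (u : G.X i ⟶ L 0)
    change (G.d (i + 1) i ≫ u) ≫ g' 0 = f (i + 1) ≫ g i ≫ u ≫ g' 0
    simp [hd]

end Bicomplex

end Extri

/-! ### The balance theorem. -/

theorem mainTheorem2 {C : Type u} [Category.{v} C] [Preadditive C] [HasZeroObject C]
    [HasBinaryBiproducts C] (𝓔 : Extri.Extriangulation.{w} C) (ξ : Extri.ProperClass 𝓔)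
    (hWIC : 𝓔.WIC) (hproj : ξ.EnoughProj) (hinj : ξ.EnoughInj)
    (M N : C) (hM : ξ.FiniteGPd M) (hN : ξ.FiniteGId N) :
    Nonempty (ξ.GProjResolution M) ∧ Nonempty (ξ.GInjCoresolution N) ∧
      ∀ (R : ξ.GProjResolution M) (S : ξ.GInjCoresolution N) (n : ℕ), 1 ≤ n →
        Nonempty (R.xt N n ≅ S.xt M n) := by
  refine ⟨hM.nonempty_resolution hproj hinj, hN.nonempty_coresolution hproj hinj,
    fun R S n hn => ?_⟩
  obtain ⟨n, rfl⟩ : ∃ m, n = m + 1 := ⟨n - 1, by omega⟩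
  have hR := fun i j => R.contraExact hM hproj hinj i (S.E.X j) (S.ginj j)
  have hS := fun i j => S.covExact hN hproj hinj j (R.G.X i) (R.gproj i)
  have := Extri.nonempty_balance_iso R.d_eq S.d_eq hR hS n
  rwa [R.K_zero, S.K_zero] at this
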